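/- **Finite types and $\textsf{E-HA}^{\omega}$.** The finite types are $0$ and $\sigma\to\tau$ for finite types $\sigma,\tau$; write $1=0\to 0$ and $2=1\to 0$. $\textsf{E-HA}^{\omega}$ is Heyting arithmetic in all finite types with extensionality: many-sorted intuitionistic predicate logic with terms built from typed variables, $0$, successor $S$, the combinators $\Pi,\Sigma$ and the recursors $R_\sigma$ of Gödel's $\mathsf{T}$ by application; the only primitive relation is $=_0$, with equality at higher types defined by $x=_{\sigma\to\tau}y:\equiv\forall z^\sigma\,(xz=_\tau yz)$; the axioms are the equality axioms for $=_0$, $Sx\neq 0$, $Sx=Sy\to x=y$, the defining equations of $\Pi,\Sigma,R_\sigma$, extensionality $x=_\rho y\to fx=_\tau fy$ in all types, and induction for all formulas of the language. **Majorizability.** $x\leq^*_0y$ is $x\leq_0 y$, and $x\leq^*_{\rho\to\sigma}y$ is $\forall v^\rho\,\forall u^\rho\,[u\leq^*_\rho v\to (xu\leq^*_\sigma yv\wedge yu\leq^*_\sigma yv)]$. An object $x$ is monotone if $x\leq^* x$; $\tilde\forall,\tilde\exists$ are quantifiers over monotone objects. **The system $\textsf{DG}$.** Extend the language by a predicate $\mathrm{st}^\sigma$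 for each finite type $\sigma$; $\forall^{\mathrm{st}},\exists^{\mathrm{st}}$ are quantifiers relativized to $\mathrm{st}$, and $\tilde\forall^{\mathrm{st}},\tilde\exists^{\mathrm{st}}$ range over the standard monotone objects. A formula is internal if it does not contain $\mathrm{st}$. $\textsf{DG}$ is the theory, in intuitionistic logic, with the following axioms, for all types, with parameters allowed, and where $\phi,\psi$ are internal and $\Phi,\Psi$ are arbitrary formulas of the extended language: * the axioms of $\textsf{E-HA}^{\omega}$ (with induction for internal formulas); * $x=y\to(\mathrm{st}(x)\to\mathrm{st}(y))$; $\ \mathrm{st}(y)\to(x\leq^*y\to\mathrm{st}(x))$; $\ \mathrm{st}(t)$ for closed terms $t$; $\ \mathrm{st}(z)\to(\mathrm{st}(x)\to\mathrm{st}(zx))$; * $\Phi(0)\wedge\forall^{\mathrm{st}}n^0(\Phi(n)\to\Phi(n+1))\to\forall^{\mathrm{st}}n^0\,\Phi(n)$; * $\textsf{mAC}^{\omega}$: $\tilde\forall^{\mathrm{st}}x\,\tilde\exists^{\mathrm{st}}y\,\Phi(x,y)\to\tilde\exists^{\mathrm{st}}f\,\tilde\forall^{\mathrm{st}}x\,\exists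 y\leq^*f(x)\,\Phi(x,y)$; * $\textsf{R}^{\omega}$: $\forall x\,\exists^{\mathrm{st}}y\,\Phi(x,y)\to\tilde\exists^{\mathrm{st}}z\,\forall x\,\exists y\leq^*z\,\Phi(x,y)$; * $\textsf{I}^{\omega}$: $\tilde\forall^{\mathrm{st}}z\,\exists x\,\forall y\leq^*z\,\phi(x,y)\to\exists x\,\forall^{\mathrm{st}}y\,\phi(x,y)$; * $\textsf{IP}^{\omega}_{\tilde\forall^{\mathrm{st}}}$: $[\tilde\forall^{\mathrm{st}}x\,\phi(x)\to\tilde\exists^{\mathrm{st}}y\,\Psi(y)]\to\tilde\exists^{\mathrm{st}}z\,[\tilde\forall^{\mathrm{st}}x\,\phi(x)\to\tilde\exists y\leq^*z\,\Psi(y)]$; * $\textsf{M}^{\omega}$: $[\tilde\forall^{\mathrm{st}}x\,\phi(x)\to\psi]\to\tilde\exists^{\mathrm{st}}y\,[\forall x\leq^*y\,\phi(x)\to\psi]$; * $\textsf{MAJ}^{\omega}$: $\forall^{\mathrm{st}}x\,\exists^{\mathrm{st}}y\,(x\leq^*y)$. **Turing jump.** For $f$ of type $1$ and $\varphi$ of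 type $2$ let $\textsf{TJ}(f,\varphi)$ be the formula $(\exists n^0)(f(n)=_0 0)\leftrightarrow\varphi(f)=_0 0$, and let $(\exists^2)$ be the axiom $(\exists\varphi^2)(\forall f^1)\,\textsf{TJ}(f,\varphi)$. **Theorem.** If $\textsf{E-HA}^{\omega}+(\exists^2)$ is consistent, then $\textsf{DG}+(\exists^{\mathrm{st}}\varphi^2)(\forall^{\mathrm{st}}f^1)\,\textsf{TJ}(f,\varphi)$ is consistent. -/

import Mathlib

/-! Heyting arithmetic in all finite types with extensionality, and its nonstandard extension
with majorizability axioms.  Syntax is intrinsically typed; variables are de Bruijn indices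
into a typing context, the head of the list being the most recently bound variable. -/

namespace FiniteType

/-- Finite types: `0` and `σ → τ`. -/
inductive Ty : Type
  | nat : Ty
  | arr : Ty → Ty → Ty

/-- The type `1 = 0 → 0`. -/
abbrev Ty.one : Ty := .arr .nat .nat
/-- The type `2 = 1 → 0`. -/
abbrev Ty.two : Ty := .arr .one .nat

abbrev Ctx : Type := List Ty

/-- Variables of a given type in a context. -/
inductive Var : Ctx → Ty → Type
  | here {Γ : Ctx} {σ : Ty} : Var (σ :: Γ) σ
  | there {Γ : Ctx} {σ τ : Ty} : Var Γ σ → Var (τ :: Γ) σ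

/-- Terms of Gödel's `T` in combinator form, with free variables in the context. -/
inductive Tm (Γ : Ctx) : Ty → Type
  | var {σ : Ty} : Var Γ σ → Tm Γ σ
  | app {σ τ : Ty} : Tm Γ (.arr σ τ) → Tm Γ σ → Tm Γ τ
  | zero : Tm Γ .nat
  | succ : Tm Γ (.arr .nat .nat)
  | proj (σ τ : Ty) : Tm Γ (.arr σ (.arr τ σ))
  | comb (ρ σ τ : Ty) :
      Tm Γ (.arr (.arr ρ (.arr σ τ)) (.arr (.arr ρ σ) (.arr ρ τ)))
  | recr (σ : Ty) :
      Tm Γ (.arr σ (.arr (.arr σ (.arr .nat σ)) (.arr .nat σ)))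

/-- Simultaneous substitutions of terms in context `Δ` for the variables of `Γ`. -/
abbrev Sub (Γ Δ : Ctx) : Type := ∀ σ : Ty, Var Γ σ → Tm Δ σ

/-- Simultaneous substitution in terms (terms have no binders). -/
def Tm.subst {Γ Δ : Ctx} (s : Sub Γ Δ) : {σ : Ty} → Tm Γ σ → Tm Δ σ
  | _, .var x => s _ x
  | _, .app t u => .app (t.subst s) (u.subst s)
  | _, .zero => .zero
  | _, .succ => .succ
  | _, .proj σ τ => .proj σ τ
  | _, .comb ρ σ τ => .comb ρ σ τ
  | _, .recr σ => .recr σ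

/-- The weakening substitution `Γ → ρ :: Γ`. -/
def Sub.shift {Γ : Ctx} (ρ : Ty) : Sub Γ (ρ :: Γ) := fun _ x => .var (.there x)

/-- Extension of a substitution by a term for a new variable. -/
def Sub.cons {Γ Δ : Ctx} {ρ : Ty} (t : Tm Δ ρ) (s : Sub Γ Δ) : Sub (ρ :: Γ) Δ
  | _, .here => t
  | _, .there x => s _ x

/-- The identity substitution. -/
def Sub.id {Γ : Ctx} : Sub Γ Γ := fun _ x => .var x

/-- Weakening of a term. -/
def Tm.wk {Γ : Ctx} {σ : Ty} (ρ : Ty) (t : Tm Γ σ) : Tm (ρ :: Γ) σ := t.subst (.shift ρ)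

/-- A substitution pushed under a binder. -/
def Sub.lift {Γ Δ : Ctx} (ρ : Ty) (s : Sub Γ Δ) : Sub (ρ :: Γ) (ρ :: Δ) :=
  .cons (.var .here) (fun σ x => (s σ x).wk ρ)

/-- The substitution out of the empty context. -/
def Sub.nil {Δ : Ctx} : Sub [] Δ := fun _ x => by cases x

/-- A closed term regarded as a term in an arbitrary context. -/
def Tm.ofClosed {Γ : Ctx} {σ : Ty} (t : Tm [] σ) : Tm Γ σ := t.subst .nil

/-- The two languages: without and with the standardness predicates. -/
inductive Lang : Type
  | internal : Lang
  | external : Lang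

/-- Formulas.  The only equality is between objects of type `0`; the predicates `st` are present
in the external language only. -/
inductive Fml (ℓ : Lang) : Ctx → Type
  | bot {Γ : Ctx} : Fml ℓ Γ
  | eq {Γ : Ctx} : Tm Γ .nat → Tm Γ .nat → Fml ℓ Γ
  | st {Γ : Ctx} {σ : Ty} (h : ℓ = .external) : Tm Γ σ → Fml ℓ Γ
  | and {Γ : Ctx} : Fml ℓ Γ → Fml ℓ Γ → Fml ℓ Γ
  | or {Γ : Ctx} : Fml ℓ Γ → Fml ℓ Γ → Fml ℓ Γ
  | imp {Γ : Ctx} : Fml ℓ Γ → Fml ℓ Γ → Fml ℓ Γ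
  | all {Γ : Ctx} (σ : Ty) : Fml ℓ (σ :: Γ) → Fml ℓ Γ
  | ex {Γ : Ctx} (σ : Ty) : Fml ℓ (σ :: Γ) → Fml ℓ Γ

/-- Capture-avoiding simultaneous substitution in formulas. -/
def Fml.subst {ℓ : Lang} : {Γ Δ : Ctx} → Sub Γ Δ → Fml ℓ Γ → Fml ℓ Δ
  | _, _, _, .bot => .bot
  | _, _, s, .eq t u => .eq (t.subst s) (u.subst s)
  | _, _, s, .st h t => .st h (t.subst s)
  | _, _, s, .and A B => .and (A.subst s) (B.subst s)
  | _, _, s, .or A B => .or (A.subst s) (B.subst s)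
  | _, _, s, .imp A B => .imp (A.subst s) (B.subst s)
  | _, _, s, .all σ A => .all σ (A.subst (s.lift σ))
  | _, _, s, .ex σ A => .ex σ (A.subst (s.lift σ))

/-- Weakening of a formula. -/
def Fml.wk {ℓ : Lang} {Γ : Ctx} (ρ : Ty) (A : Fml ℓ Γ) : Fml ℓ (ρ :: Γ) := A.subst (.shift ρ)

/-- `A(t)`, where the most recently bound variable of `A` is replaced by `t`. -/
def Fml.inst {ℓ : Lang} {Γ : Ctx} {ρ : Ty} (A : Fml ℓ (ρ :: Γ)) (t : Tm Γ ρ) : Fml ℓ Γ :=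
  A.subst (.cons t .id)

/-- An internal formula (a formula without `st`) regarded as a formula of either language. -/
def Fml.emb {ℓ : Lang} : {Γ : Ctx} → Fml .internal Γ → Fml ℓ Γ
  | _, .bot => .bot
  | _, .eq t u => .eq t u
  | _, .st h _ => nomatch h
  | _, .and A B => .and A.emb B.emb
  | _, .or A B => .or A.emb B.emb
  | _, .imp A B => .imp A.emb B.emb
  | _, .all σ A => .all σ A.emb
  | _, .ex σ A => .ex σ A.emb

/-- `st(t)` as a formula of the external language. -/
abbrev Fml.std {Γ : Ctx} {σ : Ty} (t : Tm Γ σ) : Fml .external Γ := .st rfl t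

/-- Biconditional. -/
def Fml.iff {ℓ : Lang} {Γ : Ctx} (A B : Fml ℓ Γ) : Fml ℓ Γ := .and (.imp A B) (.imp B A)

/-! ### Intuitionistic logic -/

/-- A theory: a set of axioms, possibly with free variables (parameters), in each context. -/
abbrev Theory (ℓ : Lang) : Type := ∀ Γ : Ctx, Set (Fml ℓ Γ)

/-- The theory obtained by adding one axiom, given in every context. -/
def Theory.plus {ℓ : Lang} (T : Theory ℓ) (A : ∀ Γ : Ctx, Fml ℓ Γ) : Theory ℓ :=
  fun Γ => T Γ ∪ {A Γ}

/-- Derivability from assumptions in intuitionistic many-sorted predicate logic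
(natural deduction). -/
inductive Derives {ℓ : Lang} (T : Theory ℓ) : {Γ : Ctx} → List (Fml ℓ Γ) → Fml ℓ Γ → Prop
  | ax {Γ : Ctx} {Δ : List (Fml ℓ Γ)} {A : Fml ℓ Γ} : A ∈ T Γ → Derives T Δ A
  | hyp {Γ : Ctx} {Δ : List (Fml ℓ Γ)} {A : Fml ℓ Γ} : A ∈ Δ → Derives T Δ A
  | botE {Γ : Ctx} {Δ : List (Fml ℓ Γ)} {A : Fml ℓ Γ} : Derives T Δ .bot → Derives T Δ A
  | andI {Γ : Ctx} {Δ : List (Fml ℓ Γ)} {A B : Fml ℓ Γ} :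
      Derives T Δ A → Derives T Δ B → Derives T Δ (.and A B)
  | andE₁ {Γ : Ctx} {Δ : List (Fml ℓ Γ)} {A B : Fml ℓ Γ} :
      Derives T Δ (.and A B) → Derives T Δ A
  | andE₂ {Γ : Ctx} {Δ : List (Fml ℓ Γ)} {A B : Fml ℓ Γ} :
      Derives T Δ (.and A B) → Derives T Δ B
  | orI₁ {Γ : Ctx} {Δ : List (Fml ℓ Γ)} {A B : Fml ℓ Γ} :
      Derives T Δ A → Derives T Δ (.or A B)
  | orI₂ {Γ : Ctx} {Δ : List (Fml ℓ Γ)} {A B : Fml ℓ Γ} :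
      Derives T Δ B → Derives T Δ (.or A B)
  | orE {Γ : Ctx} {Δ : List (Fml ℓ Γ)} {A B C : Fml ℓ Γ} :
      Derives T Δ (.or A B) → Derives T (A :: Δ) C → Derives T (B :: Δ) C → Derives T Δ C
  | impI {Γ : Ctx} {Δ : List (Fml ℓ Γ)} {A B : Fml ℓ Γ} :
      Derives T (A :: Δ) B → Derives T Δ (.imp A B)
  | impE {Γ : Ctx} {Δ : List (Fml ℓ Γ)} {A B : Fml ℓ Γ} :
      Derives T Δ (.imp A B) → Derives T Δ A → Derives T Δ B
  | allI {Γ : Ctx} {Δ : List (Fml ℓ Γ)} {σ : Ty} {A : Fml ℓ (σ :: Γ)} :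
      Derives T (Δ.map (Fml.wk σ)) A → Derives T Δ (.all σ A)
  | allE {Γ : Ctx} {Δ : List (Fml ℓ Γ)} {σ : Ty} {A : Fml ℓ (σ :: Γ)} (t : Tm Γ σ) :
      Derives T Δ (.all σ A) → Derives T Δ (A.inst t)
  | exI {Γ : Ctx} {Δ : List (Fml ℓ Γ)} {σ : Ty} {A : Fml ℓ (σ :: Γ)} (t : Tm Γ σ) :
      Derives T Δ (A.inst t) → Derives T Δ (.ex σ A)
  | exE {Γ : Ctx} {Δ : List (Fml ℓ Γ)} {σ : Ty} {A : Fml ℓ (σ :: Γ)} {C : Fml ℓ Γ} :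
      Derives T Δ (.ex σ A) → Derives T (A :: Δ.map (Fml.wk σ)) (C.wk σ) → Derives T Δ C

/-- A theory is consistent if it does not prove falsum. -/
def Consistent {ℓ : Lang} (T : Theory ℓ) : Prop :=
  ¬ Derives T (Γ := []) [] .bot

/-! ### Extensional Heyting arithmetic in all finite types -/

/-- The successor of a term. -/
def Tm.S {Γ : Ctx} (t : Tm Γ .nat) : Tm Γ .nat := .app .succ t

/-- Variables number 0, 1 and 2, as terms. -/
abbrev Tm.v0 {Γ : Ctx} {σ : Ty} : Tm (σ :: Γ) σ := .var .here
abbrev Tm.v1 {Γ : Ctx} {σ ρ : Ty} : Tm (ρ :: σ :: Γ) σ := .var (.there .here)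
abbrev Tm.v2 {Γ : Ctx} {σ ρ τ : Ty} : Tm (ρ :: τ :: σ :: Γ) σ := .var (.there (.there .here))

/-- Predecessor `R 0 (λ p n. n)`, with `λ p n. n` written as `Π (Σ Π Π)`. -/
def Tm.pred {Γ : Ctx} : Tm Γ (.arr .nat .nat) :=
  .app (.app (.recr .nat) .zero)
    (.app (.proj (.arr .nat .nat) .nat)
      (.app (.app (.comb .nat (.arr .nat .nat) .nat) (.proj .nat (.arr .nat .nat)))
        (.proj .nat .nat)))

/-- Cut-off subtraction `s ∸ t = R s (λ p n. pred p) t`, with `λ p n. pred p` written as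
`Σ (Π Π) pred`. -/
def Tm.monus {Γ : Ctx} (s t : Tm Γ .nat) : Tm Γ .nat :=
  .app (.app (.app (.recr .nat) s)
    (.app (.app (.comb .nat .nat (.arr .nat .nat))
      (.app (.proj (.arr .nat (.arr .nat .nat)) .nat) (.proj .nat .nat))) .pred)) t

/-- `s ≤₀ t`. -/
def Fml.le {ℓ : Lang} {Γ : Ctx} (s t : Tm Γ .nat) : Fml ℓ Γ := .eq (.monus s t) .zero

/-- Equality at type `σ`, defined pointwise from equality at type `0`. -/
def Fml.eqAt {ℓ : Lang} : {Γ : Ctx} → (σ : Ty) → Tm Γ σ → Tm Γ σ → Fml ℓ Γ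
  | _, .nat, s, t => .eq s t
  | _, .arr σ τ, s, t => .all σ (Fml.eqAt τ (.app (s.wk σ) .v0) (.app (t.wk σ) .v0))

/-- Strong majorizability `s ≤* t` (Howard, Bezem): at type `ρ → σ` it says that
`u ≤* v` implies `s u ≤* t v` and `t u ≤* t v`, for all `v` and `u`. -/
def Fml.maj {ℓ : Lang} : {Γ : Ctx} → (σ : Ty) → Tm Γ σ → Tm Γ σ → Fml ℓ Γ
  | _, .nat, s, t => .le s t
  | _, .arr ρ σ, s, t =>
      .all ρ (.all ρ (.imp (Fml.maj ρ .v0 .v1)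
        (.and (Fml.maj σ (.app ((s.wk ρ).wk ρ) .v0) (.app ((t.wk ρ).wk ρ) .v1))
          (Fml.maj σ (.app ((t.wk ρ).wk ρ) .v0) (.app ((t.wk ρ).wk ρ) .v1)))))

/-- `A(n + 1)` for `A(n)` with `n` the most recently bound variable. -/
def Fml.atSucc {ℓ : Lang} {Γ : Ctx} (A : Fml ℓ (.nat :: Γ)) : Fml ℓ (.nat :: Γ) :=
  A.subst (.cons (Tm.S .v0) (.shift .nat))

/-- The axioms of `E-HA^ω`, as formulas of either language; induction is for formulas of the
language of `E-HA^ω`, i.e. internal formulas. -/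
inductive EHA (ℓ : Lang) : (Γ : Ctx) → Fml ℓ Γ → Prop
  | eq_refl {Γ : Ctx} (s : Tm Γ .nat) : EHA ℓ Γ (.eq s s)
  | eq_symm {Γ : Ctx} (s t : Tm Γ .nat) : EHA ℓ Γ (.imp (.eq s t) (.eq t s))
  | eq_trans {Γ : Ctx} (s t u : Tm Γ .nat) :
      EHA ℓ Γ (.imp (.eq s t) (.imp (.eq t u) (.eq s u)))
  | ext {Γ : Ctx} (ρ τ : Ty) (f : Tm Γ (.arr ρ τ)) (s t : Tm Γ ρ) :
      EHA ℓ Γ (.imp (.eqAt ρ s t) (.eqAt τ (.app f s) (.app f t)))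
  | succ_ne_zero {Γ : Ctx} (s : Tm Γ .nat) : EHA ℓ Γ (.imp (.eq s.S .zero) .bot)
  | succ_inj {Γ : Ctx} (s t : Tm Γ .nat) : EHA ℓ Γ (.imp (.eq s.S t.S) (.eq s t))
  | proj {Γ : Ctx} (σ τ : Ty) (s : Tm Γ σ) (t : Tm Γ τ) :
      EHA ℓ Γ (.eqAt σ (.app (.app (.proj σ τ) s) t) s)
  | comb {Γ : Ctx} (ρ σ τ : Ty) (s : Tm Γ (.arr ρ (.arr σ τ))) (t : Tm Γ (.arr ρ σ))
      (u : Tm Γ ρ) :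
      EHA ℓ Γ (.eqAt τ (.app (.app (.app (.comb ρ σ τ) s) t) u)
        (.app (.app s u) (.app t u)))
  | rec_zero {Γ : Ctx} (σ : Ty) (s : Tm Γ σ) (t : Tm Γ (.arr σ (.arr .nat σ))) :
      EHA ℓ Γ (.eqAt σ (.app (.app (.app (.recr σ) s) t) .zero) s)
  | rec_succ {Γ : Ctx} (σ : Ty) (s : Tm Γ σ) (t : Tm Γ (.arr σ (.arr .nat σ)))
      (n : Tm Γ .nat) :
      EHA ℓ Γ (.eqAt σ (.app (.app (.app (.recr σ) s) t) n.S)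
        (.app (.app t (.app (.app (.app (.recr σ) s) t) n)) n))
  | ind {Γ : Ctx} (φ : Fml .internal (.nat :: Γ)) :
      EHA ℓ Γ (.imp (.and (φ.inst .zero).emb (.all .nat (.imp φ.emb φ.atSucc.emb)))
        (.all .nat φ.emb))

/-- The theory `E-HA^ω`, in its own language. -/
def EHAω : Theory .internal := EHA .internal

/-! ### The nonstandard system -/

/-- `(∀^st x) A`. -/
def Fml.allSt {Γ : Ctx} (σ : Ty) (A : Fml .external (σ :: Γ)) : Fml .external Γ :=
  .all σ (.imp (.std .v0) A)

/-- `(∃^st x) A`. -/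
def Fml.exSt {Γ : Ctx} (σ : Ty) (A : Fml .external (σ :: Γ)) : Fml .external Γ :=
  .ex σ (.and (.std .v0) A)

/-- `x ≤* x`, for the most recently bound variable `x`. -/
def Fml.mono {ℓ : Lang} {Γ : Ctx} (σ : Ty) : Fml ℓ (σ :: Γ) := .maj σ .v0 .v0

/-- `(∀~^st x) A`: for all standard monotone `x`. -/
def Fml.allMonSt {Γ : Ctx} (σ : Ty) (A : Fml .external (σ :: Γ)) : Fml .external Γ :=
  .allSt σ (.imp (.mono σ) A)

/-- `(∃~^st x) A`: for some standard monotone `x`. -/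
def Fml.exMonSt {Γ : Ctx} (σ : Ty) (A : Fml .external (σ :: Γ)) : Fml .external Γ :=
  .exSt σ (.and (.mono σ) A)

/-- `(∀ x ≤* t) A`. -/
def Fml.allMaj {ℓ : Lang} {Γ : Ctx} (σ : Ty) (t : Tm Γ σ) (A : Fml ℓ (σ :: Γ)) : Fml ℓ Γ :=
  .all σ (.imp (.maj σ .v0 (t.wk σ)) A)

/-- `(∃ x ≤* t) A`. -/
def Fml.exMaj {ℓ : Lang} {Γ : Ctx} (σ : Ty) (t : Tm Γ σ) (A : Fml ℓ (σ :: Γ)) : Fml ℓ Γ :=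
  .ex σ (.and (.maj σ .v0 (t.wk σ)) A)

/-- `A(x, Γ)` placed under an extra variable `z` bound just before `x`. -/
def Fml.wk1 {ℓ : Lang} {Γ : Ctx} {σ : Ty} (ρ : Ty) (A : Fml ℓ (σ :: Γ)) :
    Fml ℓ (σ :: ρ :: Γ) :=
  A.subst ((Sub.shift ρ).lift σ)

/-- `A(y, x, Γ)` placed under an extra variable `z` bound just before `x`. -/
def Fml.wk2 {ℓ : Lang} {Γ : Ctx} {σ τ : Ty} (ρ : Ty) (A : Fml ℓ (τ :: σ :: Γ)) :
    Fml ℓ (τ :: σ :: ρ :: Γ) :=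
  A.subst (((Sub.shift ρ).lift σ).lift τ)

/-- The axioms of the Dinis–Gaspar system `DG`.  In two-variable schemes `Φ(x, y)`, the variable
`x` is number 1 and `y` is number 0; in one-variable schemes the variable is number 0.  All
further free variables are parameters. -/
inductive DGAxiom : (Γ : Ctx) → Fml .external Γ → Prop
  /-- the axioms of `E-HA^ω` -/
  | eha {Γ : Ctx} {A : Fml .external Γ} : EHA .external Γ A → DGAxiom Γ A
  /-- `x = y → (st x → st y)` -/
  | st_eq {Γ : Ctx} (σ : Ty) (s t : Tm Γ σ) :
      DGAxiom Γ (.imp (.eqAt σ s t) (.imp (.std s) (.std t)))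
  /-- `st y → (x ≤* y → st x)` -/
  | st_maj {Γ : Ctx} (σ : Ty) (s t : Tm Γ σ) :
      DGAxiom Γ (.imp (.std t) (.imp (.maj σ s t) (.std s)))
  /-- closed terms are standard -/
  | st_closed {Γ : Ctx} (σ : Ty) (t : Tm [] σ) : DGAxiom Γ (.std (t.ofClosed))
  /-- `st z → (st x → st (z x))` -/
  | st_app {Γ : Ctx} (σ τ : Ty) (s : Tm Γ (.arr σ τ)) (t : Tm Γ σ) :
      DGAxiom Γ (.imp (.std s) (.imp (.std t) (.std (.app s t))))
  /-- external induction -/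
  | ind_st {Γ : Ctx} (Φ : Fml .external (.nat :: Γ)) :
      DGAxiom Γ (.imp (.and (Φ.inst .zero) (.allSt .nat (.imp Φ Φ.atSucc))) (.allSt .nat Φ))
  /-- monotone choice `mAC^ω` -/
  | mAC {Γ : Ctx} (σ τ : Ty) (Φ : Fml .external (τ :: σ :: Γ)) :
      DGAxiom Γ (.imp (.allMonSt σ (.exMonSt τ Φ))
        (.exMonSt (.arr σ τ) (.allMonSt σ
          (.exMaj τ (.app .v1 .v0) (Φ.wk2 (.arr σ τ))))))
  /-- realization `R^ω` -/
  | real {Γ : Ctx} (σ τ : Ty) (Φ : Fml .external (τ :: σ :: Γ)) :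
      DGAxiom Γ (.imp (.all σ (.exSt τ Φ))
        (.exMonSt τ (.all σ (.exMaj τ .v1 (Φ.wk2 τ)))))
  /-- idealization `I^ω` -/
  | ideal {Γ : Ctx} (σ τ : Ty) (φ : Fml .internal (τ :: σ :: Γ)) :
      DGAxiom Γ (.imp (.allMonSt τ (.ex σ (.allMaj τ .v1 (φ.wk2 τ).emb)))
        (.ex σ (.allSt τ φ.emb)))
  /-- independence of premises `IP^ω` -/
  | indepPrem {Γ : Ctx} (σ τ : Ty) (φ : Fml .internal (σ :: Γ)) (Ψ : Fml .external (τ :: Γ)) :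
      DGAxiom Γ (.imp (.imp (.allMonSt σ φ.emb) (.exMonSt τ Ψ))
        (.exMonSt τ (.imp (.allMonSt σ (φ.wk1 τ).emb)
          (.exMaj τ .v0 (.and (.mono τ) (Ψ.wk1 τ))))))
  /-- nonstandard Markov's principle `M^ω` -/
  | markov {Γ : Ctx} (σ : Ty) (φ : Fml .internal (σ :: Γ)) (ψ : Fml .internal Γ) :
      DGAxiom Γ (.imp (.imp (.allMonSt σ φ.emb) ψ.emb)
        (.exMonSt σ (.imp (.allMaj σ .v0 (φ.wk1 σ).emb) (ψ.wk σ).emb)))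
  /-- majorizability axiom `MAJ^ω` -/
  | majAx {Γ : Ctx} (σ : Ty) :
      DGAxiom Γ (.allSt σ (.exSt σ (.maj σ .v1 .v0)))

/-- The theory `DG`. -/
def DG : Theory .external := DGAxiom

/-! ### The Turing jump functional -/

/-- `TJ(f, φ)`: `(∃ n)(f n = 0) ↔ φ f = 0`. -/
def TJ {ℓ : Lang} {Γ : Ctx} (f : Tm Γ .one) (φ : Tm Γ .two) : Fml ℓ Γ :=
  .iff (.ex .nat (.eq (.app (f.wk .nat) .v0) .zero)) (.eq (.app φ f) .zero)

/-- `(∃²)`: `(∃ φ)(∀ f) TJ(f, φ)`. -/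
def existsTwo (Γ : Ctx) : Fml .internal Γ :=
  .ex .two (.all .one (TJ .v0 .v1))

/-- `(∃^st φ)(∀^st f) TJ(f, φ)`. -/
def existsTwoStd (Γ : Ctx) : Fml .external Γ :=
  .exSt .two (.allSt .one (TJ .v0 .v1))

end FiniteType

/-! The proof builds a model: the bounded functional interpretation, read semantically over the full
set-theoretic type structure. A formula denotes a relation `R x w c` between assignments `x`,
witnesses `w` and challenges `c`. Witnesses and challenges live in join semilattices with bottom,
and the relation survives enlarging `w` or shrinking `c`. A formula is valid when one witness,
chosen independently of the assignment, meets every challenge. Falsum has no witness, so validity of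
all axioms gives consistency.

The only atomic source of content is `st t`, whose witnesses are the majorants of `t`. Internal
formulas are therefore equivalent to their ordinary truth values (`Fml.exists_isProp_emb`), and the
axioms of arithmetic hold because they are true in the full structure (`EHA.valid`). Plain
quantifiers are uniform: a witness neither receives nor names the instance.

This uniformity drives the nonstandard principles. In realization, the bound on `y` cannot depend on
`x`. In idealization, `x` may be chosen after the bound on `y` is known, since the bound is a
challenge and `x` is not part of the witness. Monotone choice converts a monotone map of majorants
into a monotone functional (`El.ofHom`), and Markov's principle reads its bound off the challenge
component of an implication. Closed terms are standard by Howard's majorizability theorem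
(`Tm.eval_closed_majorizable`).

Joins replace decisions in the logical rules: challenges are joined for conjunction and witnesses
for disjunction, which makes entailment a model of intuitionistic logic (`Derives.sound`). The
Turing jump functional takes only the values 0 and 1, so the constant 1 majorizes it; its defining
property is internal and true of every `f`. -/

namespace FiniteType

/-! ### The full set-theoretic type structure -/

/-- Objects of a finite type in the full set-theoretic type structure. -/
def El : Ty → Type
  | .nat => ℕ
  | .arr σ τ => El σ → El τ

/-- Assignments of objects to the variables of a context. -/
abbrev Env (Γ : Ctx) : Type := ∀ σ : Ty, Var Γ σ → El σ

/-- Extension of an assignment to one more variable. -/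
def Env.cons {Γ : Ctx} {σ : Ty} (a : El σ) (γ : Env Γ) : Env (σ :: Γ)
  | _, .here => a
  | _, .there x => γ _ x

/-- The value of a term. -/
def Tm.eval {Γ : Ctx} (γ : Env Γ) : {σ : Ty} → Tm Γ σ → El σ
  | _, .var x => γ _ x
  | _, .app t u => (t.eval γ : El _ → El _) (u.eval γ)
  | _, .zero => (0 : ℕ)
  | _, .succ => Nat.succ
  | _, .proj _ _ => fun a _ => a
  | _, .comb _ _ _ => fun f g x => f x (g x)
  | _, .recr _ => fun a f n => Nat.rec a (fun k r => f r k) n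

/-- The assignment defined by a substitution. -/
def Sub.eval {Γ Δ : Ctx} (s : Sub Γ Δ) (δ : Env Δ) : Env Γ := fun _ x => (s _ x).eval δ

theorem Tm.eval_subst {Γ Δ : Ctx} (s : Sub Γ Δ) (δ : Env Δ) {σ : Ty} (t : Tm Γ σ) :
    (t.subst s).eval δ = t.eval (s.eval δ) := by
  induction t with
  | app t u iht ihu => simp only [Tm.subst, Tm.eval, iht, ihu]
  | _ => rfl

theorem Sub.eval_shift {Γ : Ctx} {ρ : Ty} (a : El ρ) (γ : Env Γ) :
    (Sub.shift ρ).eval (Env.cons a γ) = γ := rfl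

theorem Tm.eval_wk {Γ : Ctx} {σ ρ : Ty} (t : Tm Γ σ) (a : El ρ) (γ : Env Γ) :
    (t.wk ρ).eval (Env.cons a γ) = t.eval γ := Tm.eval_subst _ _ t

theorem Sub.eval_cons {Γ Δ : Ctx} {ρ : Ty} (t : Tm Δ ρ) (s : Sub Γ Δ) (δ : Env Δ) :
    (Sub.cons t s).eval δ = Env.cons (t.eval δ) (s.eval δ) := by
  funext σ x; cases x <;> rfl

theorem Sub.eval_lift {Γ Δ : Ctx} {ρ : Ty} (s : Sub Γ Δ) (a : El ρ) (δ : Env Δ) :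
    (s.lift ρ).eval (Env.cons a δ) = Env.cons a (s.eval δ) := by
  funext σ x
  cases x with
  | here => rfl
  | there x => exact Tm.eval_wk _ _ _

theorem Tm.eval_pred {Γ : Ctx} (γ : Env Γ) (n : ℕ) :
    (Tm.pred.eval γ : ℕ → ℕ) n = n - 1 := by
  cases n <;> rfl

theorem Tm.eval_monus {Γ : Ctx} (γ : Env Γ) (s t : Tm Γ .nat) :
    (Tm.monus s t).eval γ = Nat.sub (s.eval γ) (t.eval γ) := by
  change (Nat.rec (s.eval γ : ℕ) (fun _ r => (Tm.pred.eval γ : ℕ → ℕ) r) (t.eval γ : ℕ) : ℕ) = _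
  generalize (t.eval γ : ℕ) = n
  induction n with
  | zero => rfl
  | succ n ih =>
    change (Tm.pred.eval γ : ℕ → ℕ) _ = _
    rw [Tm.eval_pred]
    exact congrArg (· - 1) ih

/-! ### Strong majorizability in the full type structure -/

/-- Strong majorizability. -/
def Maj : (σ : Ty) → El σ → El σ → Prop
  | .nat, x, y => Nat.le x y
  | .arr ρ σ, x, y => ∀ v u : El ρ, Maj ρ u v → Maj σ (x u) (y v) ∧ Maj σ (y u) (y v)

/-- This is the purpose of the second conjunct in strong majorizability: every majorant is itself
monotone, which transitivity also relies on. -/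
theorem Maj.right : {σ : Ty} → {x y : El σ} → Maj σ x y → Maj σ y y
  | .nat, _, _, _ => Nat.le_refl _
  | .arr _ _, _, _, h => fun v u huv => ⟨(h v u huv).2, (h v u huv).2⟩

theorem Maj.trans : {σ : Ty} → {x y z : El σ} → Maj σ x y → Maj σ y z → Maj σ x z
  | .nat, _, _, _, h, k => Nat.le_trans h k
  | .arr _ _, _, _, _, h, k => fun v u huv =>
    ⟨(h v u huv).1.trans (k v v huv.right).1, (k v u huv).2⟩

/-- The hereditarily zero object. -/
def El.zero : (σ : Ty) → El σ
  | .nat => (0 : ℕ)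
  | .arr _ σ => fun _ => El.zero σ

theorem Maj.zero : {σ : Ty} → {y : El σ} → Maj σ y y → Maj σ (El.zero σ) y
  | .nat, _, _ => Nat.zero_le _
  | .arr _ _, _, h => fun v u huv => ⟨Maj.zero (h v u huv).2.right, (h v u huv).2⟩

theorem El.maj_zero : (σ : Ty) → Maj σ (El.zero σ) (El.zero σ)
  | .nat => Nat.le_refl _
  | .arr _ σ => fun _ _ _ => ⟨El.maj_zero σ, El.maj_zero σ⟩

/-- The pointwise maximum. -/
def El.sup : {σ : Ty} → El σ → El σ → El σ
  | .nat, x, y => Nat.max x y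
  | .arr _ _, x, y => fun u => El.sup (x u) (y u)

theorem Maj.sup_le : {σ : Ty} → {x y z : El σ} → Maj σ x z → Maj σ y z → Maj σ (x.sup y) z
  | .nat, _, _, _, h, k => Nat.max_le.2 ⟨h, k⟩
  | .arr _ _, _, _, _, h, k => fun v u huv =>
    ⟨Maj.sup_le (h v u huv).1 (k v u huv).1, (h v u huv).2⟩

/-- Both inclusions go through one recursion: at an arrow type each of them requires `y.sup z` to be
monotone, and this uses the two inclusions together at the result type. -/
theorem Maj.le_sup : {σ : Ty} → {x y z : El σ} → Maj σ y y → Maj σ z z →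
    (Maj σ x y → Maj σ x (y.sup z)) ∧ (Maj σ x z → Maj σ x (y.sup z))
  | .nat, _, _, _, _, _ =>
    ⟨fun h => Nat.le_trans h (Nat.le_max_left _ _), fun h => Nat.le_trans h (Nat.le_max_right _ _)⟩
  | .arr _ _, _, _, _, hy, hz => by
    have key := fun v u huv => Maj.sup_le
      ((Maj.le_sup (hy v v (Maj.right huv)).2 (hz v v (Maj.right huv)).2).1 (hy v u huv).2)
      ((Maj.le_sup (hy v v (Maj.right huv)).2 (hz v v (Maj.right huv)).2).2 (hz v u huv).2)
    exact ⟨fun h v u huv => ⟨(Maj.le_sup (hy v v huv.right).2 (hz v v huv.right).2).1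
        (h v u huv).1, key v u huv⟩,
      fun h v u huv => ⟨(Maj.le_sup (hy v v huv.right).2 (hz v v huv.right).2).2
        (h v u huv).1, key v u huv⟩⟩

theorem Maj.le_sup_left {σ : Ty} {x y z : El σ} (h : Maj σ x y) (hz : Maj σ z z) :
    Maj σ x (y.sup z) := (Maj.le_sup h.right hz).1 h

theorem Maj.le_sup_right {σ : Ty} {x y z : El σ} (h : Maj σ x z) (hy : Maj σ y y) :
    Maj σ x (y.sup z) := (Maj.le_sup hy h.right).2 h

theorem Maj.app {σ τ : Ty} {f g : El (.arr σ τ)} {x y : El σ} (h : Maj (.arr σ τ) f g)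
    (k : Maj σ x y) : Maj τ ((f : El σ → El τ) x) ((g : El σ → El τ) y) := (h y x k).1

/-- The recursor made increasing in its numerical argument. -/
def El.recMax {σ : Ty} (a : El σ) (f : El σ → ℕ → El σ) : ℕ → El σ
  | 0 => a
  | n + 1 => (El.recMax a f n).sup (f (El.recMax a f n) n)

/-- Iterates of a recursion need not grow with the numerical argument, so the recursor need not
majorize itself. Its running maximum does grow; bounding the maximum of `a`, `f` as well supplies
the monotonicity conjunct. -/
theorem Maj.recMax {σ : Ty} {a b : El σ} {f g : El (.arr σ (.arr .nat σ))} (hab : Maj σ a b)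
    (hfg : Maj (.arr σ (.arr .nat σ)) f g) (m : ℕ) : ∀ n ≤ m,
    Maj σ (Nat.rec a (fun k r => (f : El σ → ℕ → El σ) r k) n) (El.recMax b g m) ∧
      Maj σ (El.recMax a f n) (El.recMax b g m) := by
  induction m with
  | zero =>
    intro n hn
    obtain rfl : n = 0 := by omega
    exact ⟨hab, hab⟩
  | succ m ih =>
    have hm : Maj σ (El.recMax b g m) (El.recMax b g m) := (ih m le_rfl).2.right
    have step : ∀ {x : El σ}, Maj σ x (El.recMax b g m) →
        Maj σ ((f : El σ → ℕ → El σ) x m) ((g : El σ → ℕ → El σ) (El.recMax b g m) m) :=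
      fun hx => Maj.app (σ := .nat) (hfg.app hx) (Nat.le_refl m)
    intro n hn
    rcases Nat.lt_or_ge m n with h | h
    · obtain rfl : n = m + 1 := by omega
      exact ⟨(step (ih m le_rfl).1).le_sup_right hm,
        Maj.sup_le ((ih m le_rfl).2.le_sup_left (step hm).right)
          ((step (ih m le_rfl).2).le_sup_right hm)⟩
    · exact ⟨(ih n h).1.le_sup_left (step hm).right, (ih n h).2.le_sup_left (step hm).right⟩

/-- Howard's theorem: majorizability is preserved by application, and every constant other than the
recursor majorizes itself. -/
theorem Tm.eval_closed_majorizable (γ : Env []) {σ : Ty} (t : Tm [] σ) :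
    ∃ y, Maj σ (t.eval γ) y := by
  induction t with
  | var x => cases x
  | app t u iht ihu =>
    obtain ⟨y, hy⟩ := iht
    obtain ⟨z, hz⟩ := ihu
    exact ⟨(y : El _ → El _) z, hy.app hz⟩
  | zero => exact ⟨_, Nat.le_refl 0⟩
  | succ => exact ⟨Nat.succ, fun v u h => ⟨Nat.succ_le_succ h, Nat.succ_le_succ h⟩⟩
  | proj σ τ => exact ⟨fun a _ => a, fun v u h => ⟨fun _ _ _ => ⟨h, h.right⟩, fun _ _ _ => ⟨h, h.right⟩⟩⟩
  | comb ρ σ τ =>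
    have key : ∀ {f f' : El (.arr ρ (.arr σ τ))} {g g' : El (.arr ρ σ)} {x x' : El ρ},
        Maj _ f f' → Maj _ g g' → Maj _ x x' →
        Maj τ ((f : El ρ → El σ → El τ) x ((g : El ρ → El σ) x))
          ((f' : El ρ → El σ → El τ) x' ((g' : El ρ → El σ) x')) :=
      fun hf hg hx => (hf.app hx).app (hg.app hx)
    refine ⟨fun f g x => f x (g x), ?_⟩
    have : ∀ f' f, Maj (.arr ρ (.arr σ τ)) f f' →
        Maj (.arr (.arr ρ σ) (.arr ρ τ)) (fun g x => f x (g x)) (fun g x => f' x (g x)) :=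
      fun f' f hf g' g hg => ⟨fun x' x hx => ⟨key hf hg hx, key hf.right hg.right hx⟩,
        fun x' x hx => ⟨key hf.right hg hx, key hf.right hg.right hx⟩⟩
    exact fun f' f hf => ⟨this f' f hf, this f' f hf⟩
  | recr σ =>
    refine ⟨fun a f n => El.recMax a f n, fun b a hab => ⟨fun g f hfg => ⟨fun m n hn => ?_,
      fun m n hn => ?_⟩, fun g f hfg => ⟨fun m n hn => ?_, fun m n hn => ?_⟩⟩⟩
    · exact ⟨(Maj.recMax hab hfg m n hn).1, (Maj.recMax hab.right hfg.right m n hn).2⟩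
    · exact ⟨(Maj.recMax hab.right hfg m n hn).2, (Maj.recMax hab.right hfg.right m n hn).2⟩
    · exact ⟨(Maj.recMax hab hfg m n hn).2, (Maj.recMax hab.right hfg.right m n hn).2⟩
    · exact ⟨(Maj.recMax hab.right hfg m n hn).2, (Maj.recMax hab.right hfg.right m n hn).2⟩

/-! ### The lattice of majorants -/

/-- Monotone objects, preordered by majorizability. -/
def MonEl (σ : Ty) : Type := {x : El σ // Maj σ x x}

instance (σ : Ty) : Preorder (MonEl σ) where
  le x y := Maj σ x.1 y.1
  le_refl x := x.2
  le_trans _ _ _ := Maj.trans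

/-- Majorants: monotone objects up to mutual majorization. -/
def Bd (σ : Ty) : Type := Antisymmetrization (MonEl σ) (· ≤ ·)

instance (σ : Ty) : PartialOrder (Bd σ) :=
  inferInstanceAs (PartialOrder (Antisymmetrization (MonEl σ) (· ≤ ·)))

/-- A monotone object representing a majorant. -/
noncomputable def Bd.lo {σ : Ty} (m : Bd σ) : El σ := (ofAntisymmetrization (· ≤ ·) m).1

/-- The majorant represented by a monotone object. -/
def Bd.up {σ : Ty} (x : El σ) (h : Maj σ x x) : Bd σ :=
  toAntisymmetrization (· ≤ ·) (⟨x, h⟩ : MonEl σ)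

theorem Bd.lo_mono {σ : Ty} (m : Bd σ) : Maj σ m.lo m.lo := (ofAntisymmetrization (· ≤ ·) m).2

theorem Bd.le_iff {σ : Ty} {m n : Bd σ} : m ≤ n ↔ Maj σ m.lo n.lo :=
  ofAntisymmetrization_le_ofAntisymmetrization_iff.symm

theorem Bd.up_lo {σ : Ty} (m : Bd σ) : Bd.up m.lo m.lo_mono = m :=
  toAntisymmetrization_ofAntisymmetrization _ _

theorem Bd.up_le_up {σ : Ty} {x y : El σ} {hx : Maj σ x x} {hy : Maj σ y y} :
    Bd.up x hx ≤ Bd.up y hy ↔ Maj σ x y := Iff.rfl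

theorem Bd.up_le {σ : Ty} {x : El σ} {hx : Maj σ x x} {m : Bd σ} :
    Bd.up x hx ≤ m ↔ Maj σ x m.lo := by
  conv_lhs => rw [← m.up_lo]
  exact Bd.up_le_up

theorem Bd.le_up {σ : Ty} {x : El σ} {hx : Maj σ x x} {m : Bd σ} :
    m ≤ Bd.up x hx ↔ Maj σ m.lo x := by
  conv_lhs => rw [← m.up_lo]
  exact Bd.up_le_up

theorem Bd.maj_lo_up {σ : Ty} {x y : El σ} (h : Maj σ x y) (hy : Maj σ y y) :
    Maj σ x (Bd.up y hy).lo := h.trans (Bd.up_le.1 le_rfl)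

theorem Bd.maj_of_le {σ : Ty} {x : El σ} {m n : Bd σ} (h : Maj σ x m.lo) (hmn : m ≤ n) :
    Maj σ x n.lo := h.trans (Bd.le_iff.1 hmn)

/-- Majorization is not antisymmetric on monotone objects, since values at non-monotone arguments
are only bounded. Passing to classes turns the pointwise maximum into a genuine join. -/
noncomputable instance (σ : Ty) : SemilatticeSup (Bd σ) where
  sup m n := Bd.up (m.lo.sup n.lo) (m.lo_mono.le_sup_left n.lo_mono).right
  le_sup_left m n := Bd.le_up.2 (m.lo_mono.le_sup_left n.lo_mono)
  le_sup_right m n := Bd.le_up.2 (n.lo_mono.le_sup_right m.lo_mono)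
  sup_le _ _ _ h k := Bd.up_le.2 (Maj.sup_le (Bd.le_iff.1 h) (Bd.le_iff.1 k))

noncomputable instance (σ : Ty) : OrderBot (Bd σ) where
  bot := Bd.up (El.zero σ) (El.maj_zero σ)
  bot_le m := Bd.up_le.2 (Maj.zero m.lo_mono)

/-- Application of majorants. -/
noncomputable def Bd.app {σ τ : Ty} (f : Bd (.arr σ τ)) (m : Bd σ) : Bd τ :=
  Bd.up ((f.lo : El σ → El τ) m.lo) (f.lo_mono.app m.lo_mono)

theorem Bd.app_le_app {σ τ : Ty} {f g : Bd (.arr σ τ)} {m n : Bd σ} (h : f ≤ g) (k : m ≤ n) :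
    f.app m ≤ g.app n := Bd.up_le_up.2 ((Bd.le_iff.1 h).app (Bd.le_iff.1 k))

open Classical in
/-- The functional defined by a monotone map of majorants. -/
noncomputable def El.ofHom {σ τ : Ty} (F : Bd σ →o Bd τ) : El (.arr σ τ) :=
  fun x => if h : Maj σ x x then (F (Bd.up x h)).lo else El.zero τ

theorem El.ofHom_apply {σ τ : Ty} (F : Bd σ →o Bd τ) {x : El σ} (h : Maj σ x x) :
    (El.ofHom F : El σ → El τ) x = (F (Bd.up x h)).lo := dif_pos h

theorem El.maj_ofHom {σ τ : Ty} {F G : Bd σ →o Bd τ} (h : F ≤ G) :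
    Maj (.arr σ τ) (El.ofHom F) (El.ofHom G) := by
  have key : ∀ {F G : Bd σ →o Bd τ}, F ≤ G → ∀ v u, Maj σ u v →
      Maj τ ((El.ofHom F : El σ → El τ) u) ((El.ofHom G : El σ → El τ) v) := by
    intro F G h v u huv
    rw [El.ofHom_apply G huv.right]
    by_cases hu : Maj σ u u
    · rw [El.ofHom_apply F hu]
      exact Bd.le_iff.1 ((h _).trans (G.mono (Bd.up_le_up.2 huv)))
    -- An argument `u` below a monotone `v` need not be monotone. The default value zero is harmless
    -- there, as it lies below every monotone object.
    · rw [show (El.ofHom F : El σ → El τ) u = El.zero τ from dif_neg hu]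
      exact Maj.zero (Bd.lo_mono _)
  exact fun v u huv => ⟨key h v u huv, key le_rfl v u huv⟩

/-! ### Predicates with witnesses and challenges -/

/-- A predicate of the bounded functional interpretation: a relation between witnesses and
challenges, preserved by larger witnesses and by smaller challenges. -/
structure Pred (X : Type) where
  W : Type
  C : Type
  [supW : SemilatticeSup W]
  [botW : OrderBot W]
  [supC : SemilatticeSup C]
  [botC : OrderBot C]
  R : X → W → C → Prop
  mono : ∀ {x w w' c c'}, w ≤ w' → c' ≤ c → R x w c → R x w' c'

attribute [instance] Pred.supW Pred.botW Pred.supC Pred.botC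

namespace Pred

variable {X Y A : Type}

/-- Entailment, witnessed by monotone functionals independent of the parameter. -/
instance : LE (Pred X) where
  le P Q := ∃ (D : P.W →o Q.W) (E : P.W × Q.C →o P.C),
    ∀ x w c, P.R x w (E (w, c)) → Q.R x (D w) c

instance : Preorder (Pred X) where
  le_refl P := ⟨OrderHom.id, OrderHom.snd, fun _ _ _ h => h⟩
  le_trans := by
    rintro P Q S ⟨D, E, h⟩ ⟨D', E', h'⟩
    exact ⟨D'.comp D, ⟨fun p => E (p.1, E' (D p.1, p.2)), fun p q hpq =>
      E.mono ⟨hpq.1, E'.mono ⟨D.mono hpq.1, hpq.2⟩⟩⟩, fun x w c hP => h' _ _ _ (h _ _ _ hP)⟩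

theorem le_of_R {P Q : Pred X} (D : P.W → Q.W) (E : P.W × Q.C → P.C) (hD : Monotone D)
    (hE : Monotone E) (h : ∀ x w c, P.R x w (E (w, c)) → Q.R x (D w) c) : P ≤ Q :=
  ⟨⟨D, hD⟩, ⟨E, hE⟩, h⟩

/-- Reindexing. -/
def pullback (f : X → Y) (P : Pred Y) : Pred X where
  W := P.W
  C := P.C
  R x := P.R (f x)
  mono := P.mono

theorem pullback_mono (f : X → Y) {P Q : Pred Y} : P ≤ Q → P.pullback f ≤ Q.pullback f
  | ⟨D, E, h⟩ => ⟨D, E, fun x => h (f x)⟩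

/-- An ordinary predicate, without computational content. -/
def ofProp (p : X → Prop) : Pred X where
  W := Unit
  C := Unit
  R x _ _ := p x
  mono _ _ h := h

theorem ofProp_mono {p q : X → Prop} (h : ∀ x, p x → q x) : ofProp p ≤ ofProp q :=
  le_of_R (fun _ => ()) (fun _ => ()) (fun _ _ _ => le_rfl) (fun _ _ _ => le_rfl)
    fun x _ _ => h x

/-- Truth. -/
def top : Pred X := ofProp fun _ => True

/-- Falsum. -/
def bot : Pred X := ofProp fun _ => False

/-- Conjunction. -/
def and (P Q : Pred X) : Pred X where
  W := P.W × Q.W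
  C := P.C × Q.C
  R x w c := P.R x w.1 c.1 ∧ Q.R x w.2 c.2
  mono hw hc h := by
    rw [Prod.le_def] at hw hc
    exact ⟨P.mono hw.1 hc.1 h.1, Q.mono hw.2 hc.2 h.2⟩

/-- Disjunction; no disjunct is singled out. -/
def or (P Q : Pred X) : Pred X where
  W := P.W × Q.W
  C := P.C × Q.C
  R x w c := P.R x w.1 c.1 ∨ Q.R x w.2 c.2
  mono hw hc := by
    rw [Prod.le_def] at hw hc
    exact Or.imp (P.mono hw.1 hc.1) (Q.mono hw.2 hc.2)

/-- Implication. -/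
def imp (P Q : Pred X) : Pred X where
  W := (P.W →o Q.W) × (P.W × Q.C →o P.C)
  C := P.W × Q.C
  -- Quantifying over everything below the challenge forces antitonicity in `c`; the single instance
  -- at `c` would lack it, because `c.1` serves as a witness in the premise.
  R x w c := ∀ b ≤ c.1, ∀ e ≤ c.2, P.R x b (w.2 (b, e)) → Q.R x (w.1 b) e
  mono hw hc h b hb e he hP := by
    rw [Prod.le_def] at hw hc
    exact Q.mono (hw.1 b) le_rfl
      (h b (hb.trans hc.1) e (he.trans hc.2) (P.mono le_rfl (hw.2 (b, e)) hP))

/-- Universal quantification over `A`, uniform in the quantified variable. -/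
def all (f : A → X → Y) (P : Pred Y) : Pred X where
  W := P.W
  C := P.C
  R x w c := ∀ a, P.R (f a x) w c
  mono hw hc h a := P.mono hw hc (h a)

/-- Existential quantification over `A`; the instance is not part of the witness. -/
def ex (f : A → X → Y) (P : Pred Y) : Pred X where
  W := P.W
  C := P.C
  R x w c := ∃ a, P.R (f a x) w c
  mono hw hc := Exists.imp fun _ => P.mono hw hc

/-- Standardness: the witnesses are the majorants. -/
noncomputable def st {σ : Ty} (f : X → El σ) : Pred X where
  W := Bd σ
  C := Unit
  R x m _ := Maj σ (f x) m.lo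
  mono hw _ h := Bd.maj_of_le h hw

/-! ### Entailment as a Heyting prealgebra. -/

theorem le_top (P : Pred X) : P ≤ top :=
  le_of_R (fun _ => ()) (fun _ => ⊥) (fun _ _ _ => le_rfl) (fun _ _ _ => le_rfl)
    fun _ _ _ _ => trivial

theorem bot_le (P : Pred X) : bot ≤ P :=
  le_of_R (fun _ => ⊥) (fun _ => ()) (fun _ _ _ => le_rfl) (fun _ _ _ => le_rfl)
    fun _ _ _ h => h.elim

theorem and_le_left (P Q : Pred X) : P.and Q ≤ P :=
  le_of_R Prod.fst (fun p => (p.2, ⊥)) monotone_fst (fun _ _ h => ⟨h.2, le_rfl⟩)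
    fun _ _ _ h => h.1

theorem and_le_right (P Q : Pred X) : P.and Q ≤ Q :=
  le_of_R Prod.snd (fun p => (⊥, p.2)) monotone_snd (fun _ _ h => ⟨le_rfl, h.2⟩)
    fun _ _ _ h => h.2

/-- Contraction in the style of Diller and Nahm: rather than deciding which of the two challenges to
`S` is needed, their join answers both. -/
theorem le_and {P Q S : Pred X} : S ≤ P → S ≤ Q → S ≤ P.and Q := by
  rintro ⟨D, E, h⟩ ⟨D', E', h'⟩
  refine le_of_R (fun w => (D w, D' w)) (fun p => E (p.1, p.2.1) ⊔ E' (p.1, p.2.2))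
    (fun _ _ k => ⟨D.mono k, D'.mono k⟩)
    (fun _ _ k => sup_le_sup (E.mono ⟨k.1, k.2.1⟩) (E'.mono ⟨k.1, k.2.2⟩)) fun x w c hS => ?_
  exact ⟨h _ _ _ (S.mono le_rfl le_sup_left hS), h' _ _ _ (S.mono le_rfl le_sup_right hS)⟩

theorem and_mono {P P' Q Q' : Pred X} (h : P ≤ P') (k : Q ≤ Q') : P.and Q ≤ P'.and Q' :=
  le_and ((and_le_left _ _).trans h) ((and_le_right _ _).trans k)

theorem le_or_left (P Q : Pred X) : P ≤ P.or Q :=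
  le_of_R (fun w => (w, ⊥)) (fun p => p.2.1) (fun _ _ h => ⟨h, le_rfl⟩) (fun _ _ h => h.2.1)
    fun _ _ _ => Or.inl

theorem le_or_right (P Q : Pred X) : Q ≤ P.or Q :=
  le_of_R (fun w => (⊥, w)) (fun p => p.2.2) (fun _ _ h => ⟨le_rfl, h⟩) (fun _ _ h => h.2.2)
    fun _ _ _ => Or.inr

/-- No case distinction on the witness is possible, so the two candidate witnesses for `S` are
joined; whichever disjunct holds, the join is large enough. -/
theorem or_le {P Q S : Pred X} : P ≤ S → Q ≤ S → P.or Q ≤ S := by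
  rintro ⟨D, E, h⟩ ⟨D', E', h'⟩
  refine le_of_R (fun w => D w.1 ⊔ D' w.2) (fun p => (E (p.1.1, p.2), E' (p.1.2, p.2)))
    (fun _ _ k => sup_le_sup (D.mono k.1) (D'.mono k.2))
    (fun _ _ k => ⟨E.mono ⟨k.1.1, k.2⟩, E'.mono ⟨k.1.2, k.2⟩⟩) fun x w c => ?_
  rintro (hP | hQ)
  · exact S.mono le_sup_left le_rfl (h _ _ _ hP)
  · exact S.mono le_sup_right le_rfl (h' _ _ _ hQ)

theorem imp_and_le (P Q : Pred X) : (P.imp Q).and P ≤ Q :=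
  le_of_R (P := (P.imp Q).and P) (fun w => w.1.1 w.2)
    (fun p => ((p.1.2, p.2), p.1.1.2 (p.1.2, p.2)))
    (fun _ b h => (h.1.1 _).trans (b.1.1.mono h.2))
    (fun _ b h => ⟨⟨h.1.2, h.2⟩, (h.1.1.2 _).trans (b.1.1.2.mono ⟨h.1.2, h.2⟩)⟩)
    fun _ _ _ h => h.1 _ le_rfl _ le_rfl h.2

theorem le_imp {P Q S : Pred X} : P.and S ≤ Q → S ≤ P.imp Q := by
  rintro ⟨D, E, h⟩
  refine le_of_R (Q := P.imp Q)
    (fun g => (⟨fun b => D (b, g), fun _ _ k => D.mono ⟨k, le_rfl⟩⟩,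
      ⟨fun p => (E ((p.1, g), p.2)).1, fun p p' k =>
        (E.mono (show ((p.1, g), p.2) ≤ ((p'.1, g), p'.2) from ⟨⟨k.1, le_rfl⟩, k.2⟩)).1⟩))
    (fun p => (E ((p.2.1, p.1), p.2.2)).2)
    (fun g g' k => ⟨fun _ => D.mono ⟨le_rfl, k⟩, fun p =>
      (E.mono (show ((p.1, g), p.2) ≤ ((p.1, g'), p.2) from ⟨⟨le_rfl, k⟩, le_rfl⟩)).1⟩)
    (fun p p' k => (E.mono (show ((p.2.1, p.1), p.2.2) ≤ ((p'.2.1, p'.1), p'.2.2) from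
      ⟨⟨k.2.1, k.1⟩, k.2.2⟩)).2) fun x g c hS b hb e he hP => ?_
  -- By monotonicity of `E`, the one challenge to `S` computed at `c` dominates those arising from
  -- all `b` and `e` below it.
  exact h _ _ _ ⟨hP, S.mono le_rfl
    (E.mono (show ((b, g), e) ≤ ((c.1, g), c.2) from ⟨⟨hb, le_rfl⟩, he⟩)).2 hS⟩

theorem imp_elim {P Q S : Pred X} (h : S ≤ P.imp Q) (k : S ≤ P) : S ≤ Q :=
  (le_and h k).trans (imp_and_le P Q)

theorem imp_mono {P P' Q Q' : Pred X} (h : P' ≤ P) (k : Q ≤ Q') : P.imp Q ≤ P'.imp Q' :=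
  le_imp ((imp_elim (and_le_right _ _) ((and_le_left _ _).trans h)).trans k)

theorem or_mono {P P' Q Q' : Pred X} (h : P ≤ P') (k : Q ≤ Q') : P.or Q ≤ P'.or Q' :=
  or_le (h.trans (le_or_left _ _)) (k.trans (le_or_right _ _))

theorem top_le_imp {P Q : Pred X} (h : P ≤ Q) : top ≤ P.imp Q :=
  le_imp ((and_le_left _ _).trans h)

/-! ### Quantifiers as adjoints to weakening. -/

theorem le_all {f : A → X → Y} {g : Y → X} (hg : ∀ a x, g (f a x) = x) {P : Pred Y} {S : Pred X} :
    S.pullback g ≤ P → S ≤ P.all f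
  | ⟨D, E, h⟩ => ⟨D, E, fun x w c hS a => h _ _ _ (by
      change S.R (g (f a x)) w _
      rwa [hg])⟩

theorem all_le {f : A → X → Y} (t : X → A) (P : Pred Y) :
    P.all f ≤ P.pullback fun x => f (t x) x :=
  ⟨OrderHom.id, OrderHom.snd, fun x _ _ h => h (t x)⟩

theorem le_ex {f : A → X → Y} (t : X → A) (P : Pred Y) :
    (P.pullback fun x => f (t x) x) ≤ P.ex f :=
  ⟨OrderHom.id, OrderHom.snd, fun x _ _ h => ⟨t x, h⟩⟩

theorem ex_le {f : A → X → Y} {g : Y → X} (hg : ∀ a x, g (f a x) = x) {P : Pred Y} {S : Pred X} :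
    P ≤ S.pullback g → P.ex f ≤ S
  | ⟨D, E, h⟩ => ⟨D, E, fun x w c ⟨a, hP⟩ => by
      have := h _ _ _ hP
      change S.R (g (f a x)) _ c at this
      rwa [hg] at this⟩

theorem all_mono (f : A → X → Y) {P Q : Pred Y} : P ≤ Q → P.all f ≤ Q.all f
  | ⟨D, E, h⟩ => ⟨D, E, fun _ _ _ hP a => h _ _ _ (hP a)⟩

theorem ex_mono (f : A → X → Y) {P Q : Pred Y} : P ≤ Q → P.ex f ≤ Q.ex f
  | ⟨D, E, h⟩ => ⟨D, E, fun _ _ _ ⟨a, hP⟩ => ⟨a, h _ _ _ hP⟩⟩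

/-- The Beck–Chevalley condition, needed for substitution under a binder. -/
theorem all_pullback {X' Y' : Type} {f : A → X → Y} {f' : A → X' → Y'} {g : X' → X} {g' : Y' → Y}
    (h : ∀ a x, g' (f' a x) = f a (g x)) (P : Pred Y) :
    (P.pullback g').all f' = (P.all f).pullback g := by
  simp only [all, pullback, h]

theorem ex_pullback {X' Y' : Type} {f : A → X → Y} {f' : A → X' → Y'} {g : X' → X} {g' : Y' → Y}
    (h : ∀ a x, g' (f' a x) = f a (g x)) (P : Pred Y) :
    (P.pullback g').ex f' = (P.ex f).pullback g := by
  simp only [ex, pullback, h]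

end Pred

/-! ### Interpretation of formulas and soundness of intuitionistic logic -/

/-- The bounded functional interpretation of a formula over the full type structure. -/
noncomputable def Fml.interp {ℓ : Lang} : {Γ : Ctx} → Fml ℓ Γ → Pred (Env Γ)
  | _, .bot => Pred.bot
  | _, .eq t u => Pred.ofProp fun γ => t.eval γ = u.eval γ
  | _, .st _ t => Pred.st fun γ => t.eval γ
  | _, .and A B => A.interp.and B.interp
  | _, .or A B => A.interp.or B.interp
  | _, .imp A B => A.interp.imp B.interp
  | _, .all _ A => A.interp.all Env.cons
  | _, .ex _ A => A.interp.ex Env.cons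

theorem Fml.interp_subst {ℓ : Lang} {Γ Δ : Ctx} (s : Sub Γ Δ) (A : Fml ℓ Γ) :
    (A.subst s).interp = A.interp.pullback s.eval := by
  induction A generalizing Δ with
  | bot => rfl
  | eq t u => simp only [Fml.subst, Fml.interp, Tm.eval_subst]; rfl
  | st h t => simp only [Fml.subst, Fml.interp, Tm.eval_subst]; rfl
  | and A B ihA ihB => simp only [Fml.subst, Fml.interp, ihA, ihB]; rfl
  | or A B ihA ihB => simp only [Fml.subst, Fml.interp, ihA, ihB]; rfl
  | imp A B ihA ihB => simp only [Fml.subst, Fml.interp, ihA, ihB]; rfl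
  | all σ A ih =>
    rw [Fml.subst, Fml.interp, ih]
    exact Pred.all_pullback (Sub.eval_lift s) _
  | ex σ A ih =>
    rw [Fml.subst, Fml.interp, ih]
    exact Pred.ex_pullback (Sub.eval_lift s) _

/-- The tail of an assignment. -/
def Env.tail {Γ : Ctx} {σ : Ty} (γ : Env (σ :: Γ)) : Env Γ := fun _ x => γ _ (.there x)

theorem Env.tail_cons {Γ : Ctx} {σ : Ty} (a : El σ) (γ : Env Γ) : (Env.cons a γ).tail = γ := rfl

theorem Fml.interp_wk {ℓ : Lang} {Γ : Ctx} (ρ : Ty) (A : Fml ℓ Γ) :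
    (A.wk ρ).interp = A.interp.pullback Env.tail := Fml.interp_subst _ A

theorem Fml.interp_inst {ℓ : Lang} {Γ : Ctx} {ρ : Ty} (A : Fml ℓ (ρ :: Γ)) (t : Tm Γ ρ) :
    (A.inst t).interp = A.interp.pullback fun γ => Env.cons (t.eval γ) γ := by
  rw [Fml.inst, Fml.interp_subst]
  congr 1
  funext γ
  exact Sub.eval_cons _ _ _

/-- The conjunction of the interpretations of a list of assumptions. -/
noncomputable def interpList {ℓ : Lang} {Γ : Ctx} : List (Fml ℓ Γ) → Pred (Env Γ)
  | [] => Pred.top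
  | A :: Δ => A.interp.and (interpList Δ)

theorem interpList_wk {ℓ : Lang} {Γ : Ctx} (ρ : Ty) (Δ : List (Fml ℓ Γ)) :
    interpList (Δ.map (Fml.wk ρ)) = (interpList Δ).pullback Env.tail := by
  induction Δ with
  | nil => rfl
  | cons A Δ ih => simp only [List.map_cons, interpList, ih, Fml.interp_wk]; rfl

theorem interpList_le {ℓ : Lang} {Γ : Ctx} {Δ : List (Fml ℓ Γ)} {A : Fml ℓ Γ} (h : A ∈ Δ) :
    interpList Δ ≤ A.interp := by
  induction Δ with
  | nil => cases h
  | cons B Δ ih =>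
    rcases List.mem_cons.1 h with rfl | h
    · exact Pred.and_le_left _ _
    · exact (Pred.and_le_right _ _).trans (ih h)

theorem Derives.sound {ℓ : Lang} {T : Theory ℓ}
    (hT : ∀ {Γ : Ctx} {A : Fml ℓ Γ}, A ∈ T Γ → Pred.top ≤ A.interp)
    {Γ : Ctx} {Δ : List (Fml ℓ Γ)} {A : Fml ℓ Γ} (h : Derives T Δ A) :
    interpList Δ ≤ A.interp := by
  induction h with
  | ax h => exact (Pred.le_top _).trans (hT h)
  | hyp h => exact interpList_le h
  | botE _ ih => exact ih.trans (Pred.bot_le _)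
  | andI _ _ ih₁ ih₂ => exact Pred.le_and ih₁ ih₂
  | andE₁ _ ih => exact ih.trans (Pred.and_le_left _ _)
  | andE₂ _ ih => exact ih.trans (Pred.and_le_right _ _)
  | orI₁ _ ih => exact ih.trans (Pred.le_or_left _ _)
  | orI₂ _ ih => exact ih.trans (Pred.le_or_right _ _)
  | orE _ _ _ ih ih₁ ih₂ =>
    -- `Pred.or_le` admits no side assumptions, so the context is moved into each branch as an
    -- implication and discharged afterwards.
    refine Pred.imp_elim (ih.trans (Pred.or_le (Pred.le_imp ?_) (Pred.le_imp ?_))) le_rfl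
    · exact (Pred.le_and (Pred.and_le_right _ _) (Pred.and_le_left _ _)).trans ih₁
    · exact (Pred.le_and (Pred.and_le_right _ _) (Pred.and_le_left _ _)).trans ih₂
  | impI _ ih => exact Pred.le_imp ih
  | impE _ _ ih₁ ih₂ => exact Pred.imp_elim ih₁ ih₂
  | allI _ ih =>
    rw [interpList_wk] at ih
    exact Pred.le_all Env.tail_cons ih
  | allE t _ ih =>
    rw [Fml.interp_inst]
    exact ih.trans (Pred.all_le _ _)
  | exI t _ ih =>
    rw [Fml.interp_inst] at ih
    exact ih.trans (Pred.le_ex _ _)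
  | exE _ _ ih₁ ih₂ =>
    simp only [interpList, interpList_wk, Fml.interp_wk] at ih₂
    refine Pred.imp_elim (ih₁.trans (Pred.ex_le Env.tail_cons ?_)) le_rfl
    exact Pred.le_imp ((Pred.le_and (Pred.and_le_right _ _) (Pred.and_le_left _ _)).trans ih₂)

/-- Falsum has no witness, so a theory whose axioms are valid is consistent. -/
theorem consistent_of_valid {ℓ : Lang} {T : Theory ℓ}
    (hT : ∀ {Γ : Ctx} {A : Fml ℓ Γ}, A ∈ T Γ → Pred.top ≤ A.interp) : Consistent T := fun h => by
  obtain ⟨_, _, h⟩ := Derives.sound hT h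
  exact h (fun _ x => nomatch x) () () trivial

/-! ### Formulas without computational content -/

/-- A predicate equivalent to an ordinary one. -/
def Pred.IsProp {X : Type} (P : Pred X) (p : X → Prop) : Prop :=
  P ≤ Pred.ofProp p ∧ Pred.ofProp p ≤ P

namespace Pred.IsProp

variable {X Y A : Type} {P Q : Pred X} {p q : X → Prop}

theorem valid (h : P.IsProp p) (hp : ∀ x, p x) : top ≤ P :=
  (ofProp_mono fun x _ => hp x).trans h.2

theorem congr (h : P.IsProp p) (hpq : ∀ x, p x ↔ q x) : P.IsProp q :=
  ⟨h.1.trans (ofProp_mono fun x => (hpq x).1), (ofProp_mono fun x => (hpq x).2).trans h.2⟩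

theorem ofProp (p : X → Prop) : (Pred.ofProp p).IsProp p := ⟨le_rfl, le_rfl⟩

theorem pullback (f : Y → X) (h : P.IsProp p) : (P.pullback f).IsProp fun y => p (f y) :=
  ⟨pullback_mono f h.1, pullback_mono f h.2⟩

theorem and (h : P.IsProp p) (k : Q.IsProp q) : (P.and Q).IsProp fun x => p x ∧ q x :=
  ⟨(and_mono h.1 k.1).trans (le_of_R (fun _ => ()) (fun _ => ((), ())) (fun _ _ _ => le_rfl)
      (fun _ _ _ => le_rfl) fun _ _ _ h => h),
    le_trans (le_of_R (fun _ => ((), ())) (fun _ => ()) (fun _ _ _ => le_rfl)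
      (fun _ _ _ => le_rfl) fun _ _ _ h => h) (and_mono h.2 k.2)⟩

theorem or (h : P.IsProp p) (k : Q.IsProp q) : (P.or Q).IsProp fun x => p x ∨ q x :=
  ⟨(or_mono h.1 k.1).trans (le_of_R (fun _ => ()) (fun _ => ((), ())) (fun _ _ _ => le_rfl)
      (fun _ _ _ => le_rfl) fun _ _ _ h => h),
    le_trans (le_of_R (fun _ => ((), ())) (fun _ => ()) (fun _ _ _ => le_rfl)
      (fun _ _ _ => le_rfl) fun _ _ _ h => h) (or_mono h.2 k.2)⟩

theorem imp (h : P.IsProp p) (k : Q.IsProp q) : (P.imp Q).IsProp fun x => p x → q x :=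
  ⟨(imp_mono h.2 k.1).trans (le_of_R (fun _ => ()) (fun _ => ((), ())) (fun _ _ _ => le_rfl)
      (fun _ _ _ => le_rfl) fun _ _ _ h => h () le_rfl () le_rfl),
    le_trans (le_of_R (fun _ => ⊥) (fun _ => ()) (fun _ _ _ => le_rfl)
      (fun _ _ _ => le_rfl) fun _ _ _ h _ _ _ _ => h) (imp_mono h.1 k.2)⟩

theorem all (f : A → Y → X) (h : P.IsProp p) : (P.all f).IsProp fun y => ∀ a, p (f a y) :=
  ⟨(all_mono f h.1).trans (le_of_R (fun _ => ()) (fun _ => ()) (fun _ _ _ => le_rfl)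
      (fun _ _ _ => le_rfl) fun _ _ _ h => h),
    le_trans (le_of_R (fun _ => ()) (fun _ => ()) (fun _ _ _ => le_rfl)
      (fun _ _ _ => le_rfl) fun _ _ _ h => h) (all_mono f h.2)⟩

theorem ex (f : A → Y → X) (h : P.IsProp p) : (P.ex f).IsProp fun y => ∃ a, p (f a y) :=
  ⟨(ex_mono f h.1).trans (le_of_R (fun _ => ()) (fun _ => ()) (fun _ _ _ => le_rfl)
      (fun _ _ _ => le_rfl) fun _ _ _ h => h),
    le_trans (le_of_R (fun _ => ()) (fun _ => ()) (fun _ _ _ => le_rfl)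
      (fun _ _ _ => le_rfl) fun _ _ _ h => h) (ex_mono f h.2)⟩

end Pred.IsProp

theorem Fml.emb_subst {ℓ : Lang} {Γ Δ : Ctx} (s : Sub Γ Δ) (φ : Fml .internal Γ) :
    (φ.subst s).emb (ℓ := ℓ) = φ.emb.subst s := by
  induction φ generalizing Δ with
  | bot => rfl
  | eq t u => rfl
  | st h t => exact nomatch h
  | and A B ihA ihB => simp only [Fml.subst, Fml.emb, ihA, ihB]
  | or A B ihA ihB => simp only [Fml.subst, Fml.emb, ihA, ihB]
  | imp A B ihA ihB => simp only [Fml.subst, Fml.emb, ihA, ihB]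
  | all σ A ih => simp only [Fml.subst, Fml.emb, ih]
  | ex σ A ih => simp only [Fml.subst, Fml.emb, ih]

/-- Witness types of internal formulas are built from `Unit` by products and monotone maps, so they
are not literally trivial. Equivalence with a predicate over `Unit` is the usable form. -/
theorem Fml.exists_isProp_emb {ℓ : Lang} {Γ : Ctx} (φ : Fml .internal Γ) :
    ∃ p, (φ.emb (ℓ := ℓ)).interp.IsProp p := by
  induction φ with
  | bot => exact ⟨_, .ofProp _⟩
  | eq t u => exact ⟨_, .ofProp _⟩
  | st h t => exact nomatch h
  | and A B ihA ihB => exact ⟨_, ihA.choose_spec.and ihB.choose_spec⟩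
  | or A B ihA ihB => exact ⟨_, ihA.choose_spec.or ihB.choose_spec⟩
  | imp A B ihA ihB => exact ⟨_, ihA.choose_spec.imp ihB.choose_spec⟩
  | all σ A ih => exact ⟨_, ih.choose_spec.all _⟩
  | ex σ A ih => exact ⟨_, ih.choose_spec.ex _⟩

theorem Fml.isProp_eqAt {ℓ : Lang} {Γ : Ctx} {σ : Ty} (s t : Tm Γ σ) :
    (Fml.eqAt (ℓ := ℓ) σ s t).interp.IsProp fun γ => s.eval γ = t.eval γ := by
  induction σ generalizing Γ with
  | nat => exact .ofProp _
  | arr σ τ _ ih =>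
    refine ((ih _ _).all _).congr fun γ => ?_
    simp only [Tm.eval, Tm.eval_wk]
    exact funext_iff.symm

theorem Fml.isProp_maj {ℓ : Lang} {Γ : Ctx} {σ : Ty} (s t : Tm Γ σ) :
    (Fml.maj (ℓ := ℓ) σ s t).interp.IsProp fun γ => Maj σ (s.eval γ) (t.eval γ) := by
  induction σ generalizing Γ with
  | nat =>
    refine (Pred.IsProp.ofProp _).congr fun γ => ?_
    rw [Tm.eval_monus]
    exact Nat.sub_eq_zero_iff_le
  | arr ρ σ ihρ ihσ =>
    refine ((((ihρ _ _).imp ((ihσ _ _).and (ihσ _ _))).all _).all _).congr fun γ => ?_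
    simp only [Tm.eval, Tm.eval_wk]
    exact Iff.rfl

theorem Fml.isProp_mono {ℓ : Lang} {Γ : Ctx} {σ : Ty} :
    (Fml.mono (ℓ := ℓ) (Γ := Γ) σ).interp.IsProp fun γ => Maj σ (γ _ .here) (γ _ .here) :=
  Fml.isProp_maj _ _

theorem EHA.valid {ℓ : Lang} {Γ : Ctx} {A : Fml ℓ Γ} (h : EHA ℓ Γ A) : Pred.top ≤ A.interp := by
  cases h with
  | eq_refl s => exact (Pred.IsProp.ofProp _).valid fun _ => rfl
  | eq_symm s t => exact ((Pred.IsProp.ofProp _).imp (.ofProp _)).valid fun _ => Eq.symm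
  | eq_trans s t u =>
    exact ((Pred.IsProp.ofProp _).imp ((Pred.IsProp.ofProp _).imp (.ofProp _))).valid
      fun _ => Eq.trans
  | ext ρ τ f s t =>
    exact ((Fml.isProp_eqAt _ _).imp (Fml.isProp_eqAt _ _)).valid fun γ =>
      congrArg (f.eval γ : El ρ → El τ)
  | succ_ne_zero s =>
    exact ((Pred.IsProp.ofProp _).imp (.ofProp _)).valid fun _ => Nat.succ_ne_zero _
  | succ_inj s t => exact ((Pred.IsProp.ofProp _).imp (.ofProp _)).valid fun _ => Nat.succ.inj
  | proj σ τ s t => exact (Fml.isProp_eqAt _ _).valid fun _ => rfl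
  | comb ρ σ τ s t u => exact (Fml.isProp_eqAt _ _).valid fun _ => rfl
  | rec_zero σ s t => exact (Fml.isProp_eqAt _ _).valid fun _ => rfl
  | rec_succ σ s t n => exact (Fml.isProp_eqAt _ _).valid fun _ => rfl
  | ind φ =>
    obtain ⟨p, hp⟩ := Fml.exists_isProp_emb (ℓ := ℓ) φ
    have h0 := hp.pullback fun γ => Env.cons (Tm.eval γ .zero) γ
    rw [← Fml.interp_inst, Fml.inst, ← Fml.emb_subst] at h0
    have hS := hp.pullback (Sub.cons (Tm.S .v0) (.shift .nat)).eval
    rw [← Fml.interp_subst, ← Fml.emb_subst] at hS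
    refine ((h0.and ((hp.imp hS).all _)).imp (hp.all _)).valid fun γ h n => ?_
    induction n using Nat.rec with
    | zero => exact h.1
    | succ n ih =>
      have := h.2 n ih
      rw [Sub.eval_cons] at this
      exact this

/-! ### Relativized and bounded quantifiers -/

namespace Pred

variable {Γ : Ctx} {σ τ : Ty}

/-- Quantification over all standard objects. -/
noncomputable def allSt (P : Pred (Env (σ :: Γ))) : Pred (Env Γ) where
  W := Bd σ →o P.W
  C := Bd σ × P.C
  R γ F c := ∀ x, ∀ m ≤ c.1, Maj σ x m.lo → P.R (Env.cons x γ) (F m) c.2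
  mono hw hc h x m hm hx := by
    rw [Prod.le_def] at hc
    exact P.mono (hw m) hc.2 (h x m (hm.trans hc.1) hx)

/-- Quantification over all standard monotone objects. -/
noncomputable def allMon (P : Pred (Env (σ :: Γ))) : Pred (Env Γ) where
  W := Bd σ →o P.W
  C := Bd σ × P.C
  R γ F c := ∀ x (h : Maj σ x x), Maj σ x c.1.lo → P.R (Env.cons x γ) (F (Bd.up x h)) c.2
  mono hw hc h x hx hm := by
    rw [Prod.le_def] at hc
    exact P.mono (hw _) hc.2 (h x hx (Bd.maj_of_le hm hc.1))

/-- Quantification over all standard monotone objects of an ordinary predicate. -/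
noncomputable def allMonProp (p : Env (σ :: Γ) → Prop) : Pred (Env Γ) where
  W := Unit
  C := Bd σ
  R γ _ m := ∀ x, Maj σ x x → Maj σ x m.lo → p (Env.cons x γ)
  mono _ hc h x hx hm := h x hx (Bd.maj_of_le hm hc)

/-- Existence of a standard object. -/
noncomputable def exSt (P : Pred (Env (σ :: Γ))) : Pred (Env Γ) where
  W := Bd σ × P.W
  C := P.C
  R γ w c := ∃ x, Maj σ x w.1.lo ∧ P.R (Env.cons x γ) w.2 c
  mono hw hc := by
    rw [Prod.le_def] at hw
    rintro ⟨x, hx, h⟩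
    exact ⟨x, Bd.maj_of_le hx hw.1, P.mono hw.2 hc h⟩

/-- Existence of a standard monotone object. -/
noncomputable def exMon (P : Pred (Env (σ :: Γ))) : Pred (Env Γ) where
  W := Bd σ × P.W
  C := P.C
  R γ w c := ∃ x, Maj σ x w.1.lo ∧ Maj σ x x ∧ P.R (Env.cons x γ) w.2 c
  mono hw hc := by
    rw [Prod.le_def] at hw
    rintro ⟨x, hx, hxx, h⟩
    exact ⟨x, Bd.maj_of_le hx hw.1, hxx, P.mono hw.2 hc h⟩

/-- Existence of an object below a given one. -/
def exMaj (t : Env Γ → El σ) (P : Pred (Env (σ :: Γ))) : Pred (Env Γ) where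
  W := P.W
  C := P.C
  R γ w c := ∃ x, Maj σ x (t γ) ∧ P.R (Env.cons x γ) w c
  mono hw hc := Exists.imp fun _ => And.imp_right (P.mono hw hc)

end Pred

section Quantifiers

variable {Γ : Ctx} {σ : Ty}

theorem Pred.allSt_equiv (P : Pred (Env (σ :: Γ))) :
    ((Pred.st fun γ : Env (σ :: Γ) => γ _ .here).imp P).all Env.cons ≤ P.allSt ∧
      P.allSt ≤ ((Pred.st fun γ : Env (σ :: Γ) => γ _ .here).imp P).all Env.cons := by
  constructor
  · exact Pred.le_of_R (P := ((Pred.st fun γ : Env (σ :: Γ) => γ _ .here).imp P).all Env.cons)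
      (Q := P.allSt) (fun w => w.1) (fun p => p.2) (fun _ _ h => h.1) (fun _ _ h => h.2)
      fun γ w c h x m hm hx => h x m hm _ le_rfl hx
  · exact Pred.le_of_R (Q := ((Pred.st fun γ : Env (σ :: Γ) => γ _ .here).imp P).all Env.cons)
      (P := P.allSt) (fun w => (w, ⊥)) (fun p => p.2) (fun _ _ h => ⟨h, le_rfl⟩) (fun _ _ h => h.2)
      fun γ w c h x m hm e he hx => P.mono le_rfl he (h x m hm hx)

theorem Fml.allSt_le {A : Fml .external (σ :: Γ)} {P : Pred (Env (σ :: Γ))} (h : A.interp ≤ P) :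
    (Fml.allSt σ A).interp ≤ P.allSt :=
  (Pred.all_mono _ (Pred.imp_mono le_rfl h)).trans (Pred.allSt_equiv P).1

theorem Fml.le_allSt {A : Fml .external (σ :: Γ)} {P : Pred (Env (σ :: Γ))} (h : P ≤ A.interp) :
    P.allSt ≤ (Fml.allSt σ A).interp :=
  (Pred.allSt_equiv P).2.trans (Pred.all_mono _ (Pred.imp_mono le_rfl h))

/-- A monotone `x` is its own least majorant. A witness evaluated at the class of `x` thus suffices,
and monotonicity of `F` recovers its value at any larger majorant. -/
theorem Pred.allMon_equiv {P Q : Pred (Env (σ :: Γ))}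
    (hQ : Q.IsProp fun γ => Maj σ (γ _ .here) (γ _ .here)) :
    (Q.imp P).allSt ≤ P.allMon ∧ P.allMon ≤ (Q.imp P).allSt := by
  obtain ⟨⟨D, E, h₁⟩, ⟨D', E', h₂⟩⟩ := hQ
  constructor
  · refine Pred.le_of_R (P := (Q.imp P).allSt) (Q := P.allMon)
      (fun F : Bd σ →o (Q.W →o P.W) × (Q.W × P.C →o Q.C) =>
        ⟨fun m => (F m).1 (D' ()), fun _ _ h => (F.mono h).1 _⟩)
      (fun p => (p.2.1, (D' (), p.2.2))) (fun _ _ h m => (h m).1 _)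
      (fun _ _ h => ⟨h.2.1, le_rfl, h.2.2⟩) fun γ F c h x hx hm => ?_
    exact h x _ (Bd.up_le.2 hm) (Bd.maj_lo_up hx hx) _ le_rfl _ le_rfl (h₂ _ _ _ hx)
  · refine Pred.le_of_R (Q := (Q.imp P).allSt) (P := P.allMon)
      (fun F : Bd σ →o P.W => ⟨fun m => (⟨fun _ => F m, fun _ _ _ => le_rfl⟩,
        ⟨fun p => E (p.1, ()), fun _ _ h => E.mono ⟨h.1, le_rfl⟩⟩), fun _ _ h =>
        ⟨fun _ => F.mono h, fun _ => le_rfl⟩⟩)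
      (fun p => (p.2.1, p.2.2.2)) (fun _ _ h m => ⟨fun _ => h m, fun _ => le_rfl⟩)
      (fun _ _ h => ⟨h.2.1, h.2.2.2⟩) fun γ F c h x m hm hx b hb e he hQ => ?_
    have hxx := h₁ _ _ _ hQ
    exact P.mono (F.mono (Bd.up_le.2 hx)) he (h x hxx (Bd.maj_of_le hx hm))

theorem Fml.allMonSt_le {A : Fml .external (σ :: Γ)} {P : Pred (Env (σ :: Γ))}
    (h : A.interp ≤ P) : (Fml.allMonSt σ A).interp ≤ P.allMon :=
  (Fml.allSt_le (Pred.imp_mono le_rfl h)).trans (Pred.allMon_equiv Fml.isProp_mono).1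

theorem Fml.le_allMonSt {A : Fml .external (σ :: Γ)} {P : Pred (Env (σ :: Γ))}
    (h : P ≤ A.interp) : P.allMon ≤ (Fml.allMonSt σ A).interp :=
  (Pred.allMon_equiv Fml.isProp_mono).2.trans (Fml.le_allSt (Pred.imp_mono le_rfl h))

theorem Fml.allMonSt_le_allMonProp {A : Fml .external (σ :: Γ)} {p : Env (σ :: Γ) → Prop}
    (h : A.interp.IsProp p) : (Fml.allMonSt σ A).interp ≤ Pred.allMonProp p :=
  (Fml.allMonSt_le h.1).trans (Pred.le_of_R (P := (Pred.ofProp p).allMon) (Q := Pred.allMonProp p)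
    (fun _ => ()) (fun p => (p.2, ())) (fun _ _ _ => le_rfl) (fun _ _ h => ⟨h.2, le_rfl⟩)
    fun _ _ _ h => h)

theorem Fml.allMonProp_le_allMonSt {A : Fml .external (σ :: Γ)} {p : Env (σ :: Γ) → Prop}
    (h : A.interp.IsProp p) : Pred.allMonProp p ≤ (Fml.allMonSt σ A).interp :=
  le_trans (Pred.le_of_R (Q := (Pred.ofProp p).allMon) (P := Pred.allMonProp p)
    (fun _ => ⊥) (fun p => p.2.1) (fun _ _ _ => le_rfl) (fun _ _ h => h.2.1)
    fun _ _ _ h => h) (Fml.le_allMonSt h.2)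

theorem Fml.exSt_le {A : Fml .external (σ :: Γ)} {P : Pred (Env (σ :: Γ))} (h : A.interp ≤ P) :
    (Fml.exSt σ A).interp ≤ P.exSt :=
  (Pred.ex_mono _ (Pred.and_mono le_rfl h)).trans
    (Pred.le_of_R (P := ((Pred.st fun γ : Env (σ :: Γ) => γ _ .here).and P).ex Env.cons)
      (Q := P.exSt) (fun w => w) (fun p => ((), p.2)) (fun _ _ h => h)
      (fun _ _ h => ⟨le_rfl, h.2⟩) fun _ _ _ h => h)

theorem Fml.le_exSt {A : Fml .external (σ :: Γ)} {P : Pred (Env (σ :: Γ))} (h : P ≤ A.interp) :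
    P.exSt ≤ (Fml.exSt σ A).interp :=
  le_trans
    (Pred.le_of_R (Q := ((Pred.st fun γ : Env (σ :: Γ) => γ _ .here).and P).ex Env.cons)
      (P := P.exSt) (fun w => w) (fun p => p.2.2) (fun _ _ h => h)
      (fun _ _ h => h.2.2) fun _ _ _ h => h)
    (Pred.ex_mono _ (Pred.and_mono le_rfl h))

theorem Pred.exMon_equiv {P Q : Pred (Env (σ :: Γ))}
    (hQ : Q.IsProp fun γ => Maj σ (γ _ .here) (γ _ .here)) :
    (Q.and P).exSt ≤ P.exMon ∧ P.exMon ≤ (Q.and P).exSt := by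
  obtain ⟨⟨D, E, h₁⟩, ⟨D', E', h₂⟩⟩ := hQ
  constructor
  · refine Pred.le_of_R (P := (Q.and P).exSt) (Q := P.exMon)
      (fun w => (w.1, w.2.2)) (fun p => (E (p.1.2.1, ()), p.2)) (fun _ _ h => ⟨h.1, h.2.2⟩)
      (fun _ _ h => ⟨E.mono ⟨h.1.2.1, le_rfl⟩, h.2⟩) ?_
    rintro γ w c ⟨x, hx, hQ, hP⟩
    exact ⟨x, hx, h₁ _ _ _ hQ, hP⟩
  · refine Pred.le_of_R (Q := (Q.and P).exSt) (P := P.exMon)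
      (fun w => (w.1, (D' (), w.2))) (fun p => p.2.2) (fun _ _ h => ⟨h.1, le_rfl, h.2⟩)
      (fun _ _ h => h.2.2) ?_
    rintro γ w c ⟨x, hx, hxx, hP⟩
    exact ⟨x, hx, h₂ _ _ _ hxx, hP⟩

theorem Fml.exMonSt_le {A : Fml .external (σ :: Γ)} {P : Pred (Env (σ :: Γ))}
    (h : A.interp ≤ P) : (Fml.exMonSt σ A).interp ≤ P.exMon :=
  (Fml.exSt_le (Pred.and_mono le_rfl h)).trans (Pred.exMon_equiv Fml.isProp_mono).1

theorem Fml.le_exMonSt {A : Fml .external (σ :: Γ)} {P : Pred (Env (σ :: Γ))}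
    (h : P ≤ A.interp) : P.exMon ≤ (Fml.exMonSt σ A).interp :=
  (Pred.exMon_equiv Fml.isProp_mono).2.trans (Fml.le_exSt (Pred.and_mono le_rfl h))

theorem Fml.le_exMaj {ℓ : Lang} {t : Tm Γ σ} {A : Fml ℓ (σ :: Γ)} {P : Pred (Env (σ :: Γ))}
    (h : P ≤ A.interp) : P.exMaj (fun γ => t.eval γ) ≤ (Fml.exMaj σ t A).interp := by
  refine le_trans ?_ (Pred.ex_mono _ (Pred.and_mono (Fml.isProp_maj _ _).2 h))
  refine Pred.le_of_R (P := P.exMaj fun γ => t.eval γ)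
    (Q := ((Pred.ofProp fun γ : Env (σ :: Γ) => Maj σ (γ _ .here) ((t.wk σ).eval γ)).and P).ex
      Env.cons)
    (fun w => ((), w)) (fun p => p.2.2) (fun _ _ h => ⟨le_rfl, h⟩) (fun _ _ h => h.2.2) ?_
  rintro γ w c ⟨x, hx, h⟩
  exact ⟨x, (congrArg (Maj σ x) (Tm.eval_wk t x γ)).mpr hx, h⟩

theorem Fml.isProp_allMaj {ℓ : Lang} {t : Tm Γ σ} {A : Fml ℓ (σ :: Γ)} {p : Env (σ :: Γ) → Prop}
    (h : A.interp.IsProp p) : (Fml.allMaj σ t A).interp.IsProp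
      fun γ => ∀ x, Maj σ x (t.eval γ) → p (Env.cons x γ) := by
  refine (((Fml.isProp_maj _ _).imp h).all _).congr fun γ => ?_
  simp only [Tm.eval_wk]
  exact Iff.rfl

end Quantifiers

/-! ### Validity of the nonstandard axioms -/

theorem Fml.valid_imp_imp {ℓ : Lang} {Γ : Ctx} {A B C : Fml ℓ Γ}
    (h : B.interp.and A.interp ≤ C.interp) : Pred.top ≤ (Fml.imp A (.imp B C)).interp :=
  Pred.top_le_imp (Pred.le_imp h)

namespace Pred

variable {Γ : Ctx} {σ τ : Ty}

theorem st_and_le {X : Type} {f g : X → El σ} {Q : Pred X} {p : X → Prop} (hQ : Q.IsProp p)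
    (h : ∀ x, p x → ∀ m : Bd σ, Maj σ (f x) m.lo → Maj σ (g x) m.lo) :
    (st f).and Q ≤ st g := by
  refine (and_mono le_rfl hQ.1).trans (le_of_R (P := (st f).and (.ofProp p)) (Q := st g)
    Prod.fst (fun _ => ((), ())) monotone_fst (fun _ _ _ => le_rfl) fun x w _ hP => ?_)
  exact h x hP.2 _ hP.1

theorem and_st_le {X : Type} {f g : X → El σ} {Q : Pred X} {p : X → Prop} (hQ : Q.IsProp p)
    (h : ∀ x, p x → ∀ m : Bd σ, Maj σ (f x) m.lo → Maj σ (g x) m.lo) :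
    Q.and (st f) ≤ st g :=
  (le_and (and_le_right _ _) (and_le_left _ _)).trans (st_and_le hQ h)

theorem st_app {X : Type} (f : X → El (.arr σ τ)) (g : X → El σ) :
    (st g).and (st f) ≤ st fun x => (f x : El σ → El τ) (g x) :=
  le_of_R (P := (st g).and (st f)) (Q := st fun x => (f x : El σ → El τ) (g x))
    (fun w => Bd.app w.2 w.1) (fun _ => ((), ())) (fun _ _ h => Bd.app_le_app h.2 h.1)
    (fun _ _ _ => le_rfl) fun _ w _ h => Bd.maj_lo_up (h.2.app h.1) (w.2.lo_mono.app w.1.lo_mono)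

/-- Iterated witnesses for external induction. -/
def indW {W C : Type} [SemilatticeSup W] [SemilatticeSup C]
    (H : (W →o W) × (W × C →o C)) (w : W) : ℕ → W
  | 0 => w
  | n + 1 => indW H w n ⊔ H.1 (indW H w n)

/-- Iterated challenges for external induction. -/
def indC {W C : Type} [SemilatticeSup W] [SemilatticeSup C]
    (H : (W →o W) × (W × C →o C)) (w : W) (c : C) : ℕ → C
  | 0 => c
  | n + 1 => indC H w c n ⊔ H.2 (w, indC H w c n)

section Iteration

variable {W C : Type} [SemilatticeSup W] [SemilatticeSup C]
  {H H' : (W →o W) × (W × C →o C)} {w w' : W} {c c' : C} {m n : ℕ}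

theorem indW_le_indW (hH : H ≤ H') (hw : w ≤ w') (hmn : m ≤ n) : indW H w m ≤ indW H' w' n := by
  refine le_trans ?_ (monotone_nat_of_le_succ (f := indW H' w') (fun _ => le_sup_left) hmn)
  induction m with
  | zero => exact hw
  | succ m ih =>
    have := ih (by omega)
    exact sup_le_sup this ((hH.1 _).trans (H'.1.mono this))

theorem indC_le_indC (hH : H ≤ H') (hw : w ≤ w') (hc : c ≤ c') (hmn : m ≤ n) :
    indC H w c m ≤ indC H' w' c' n := by
  refine le_trans ?_ (monotone_nat_of_le_succ (f := indC H' w' c') (fun _ => le_sup_left) hmn)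
  induction m with
  | zero => exact hc
  | succ m ih =>
    have := ih (by omega)
    exact sup_le_sup this ((hH.2 _).trans (H'.2.mono ⟨hw, this⟩))

end Iteration

/-- A bound `N` on `n` tells how often to iterate the step witness, starting from the base witness.
Challenges are iterated the opposite way, from the final challenge back to the base case, with the
witness argument frozen at its largest value `V t N`. The joins in `indW` and `indC` make the
iterates increasing, so a bound on `n` can replace `n`. -/
theorem external_induction (P : Pred (Env (.nat :: Γ))) {z : Env Γ → Env (.nat :: Γ)}
    {s : Env (.nat :: Γ) → Env (.nat :: Γ)} (hz : ∀ γ, z γ = Env.cons (σ := .nat) (0 : ℕ) γ)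
    (hs : ∀ (n : ℕ) (γ : Env Γ), s (Env.cons (σ := .nat) n γ) =
      Env.cons (σ := .nat) (n + 1 : ℕ) γ) :
    (P.pullback z).and (P.imp (P.pullback s)).allSt ≤ P.allSt := by
  let T : Type := P.W × (Bd .nat →o (P.W →o P.W) × (P.W × P.C →o P.C))
  let lo : Bd .nat → ℕ := Bd.lo
  have lo_le : ∀ {m n : Bd .nat}, m ≤ n → lo m ≤ lo n := fun h => Bd.le_iff.1 h
  let V : T → Bd .nat → P.W := fun t N => indW (t.2 N) t.1 (lo N)
  have V_le : ∀ {t t' : T} {N N' : Bd .nat}, t ≤ t' → N ≤ N' → V t N ≤ V t' N' :=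
    fun {t t' N N'} h k => indW_le_indW ((h.2 N).trans (t'.2.mono k)) h.1 (lo_le k)
  let K : T → Bd .nat → P.C → P.C := fun t N c => indC (t.2 N) (V t N) c (lo N)
  have K_le : ∀ {t t' : T} {N N' : Bd .nat} {c c' : P.C}, t ≤ t' → N ≤ N' → c ≤ c' →
      K t N c ≤ K t' N' c' := fun {t t' N N' c c'} h k hc =>
    indC_le_indC ((h.2 N).trans (t'.2.mono k)) (V_le h k) hc (lo_le k)
  refine le_of_R (P := (P.pullback z).and (P.imp (P.pullback s)).allSt) (Q := P.allSt)
    (fun t : T => ⟨V t, fun _ _ h => V_le le_rfl h⟩)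
    (fun p : T × (Bd .nat × P.C) => (K p.1 p.2.1 p.2.2, (p.2.1, (V p.1 p.2.1, K p.1 p.2.1 p.2.2))))
    (fun _ _ h N => V_le h le_rfl)
    (fun _ _ h => ⟨K_le h.1 h.2.1 h.2.2, h.2.1, V_le h.1 h.2.1, K_le h.1 h.2.1 h.2.2⟩) ?_
  rintro γ t ⟨N, c⟩ ⟨h0, hS⟩ (n : ℕ) m hm (hn : n ≤ lo m)
  change T at t
  have hN : lo m ≤ lo N := lo_le hm
  -- After `k` steps forward for the witness, `j = n - k` backward steps remain for the challenge.
  -- Each use of the step hypothesis consumes one of them, and `k = n` leaves the original challenge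
  -- `c`.
  have key : ∀ k j : ℕ, k + j = n →
      P.R (Env.cons (σ := .nat) k γ) (indW (t.2 m) t.1 k) (indC (t.2 m) (V t m) c j) := by
    intro k
    induction k with
    | zero =>
      intro j hj
      have h0 : P.R (z γ) t.1 (K t N c) := h0
      rw [hz] at h0
      exact P.mono le_rfl (indC_le_indC (t.2.mono hm) (V_le le_rfl hm) le_rfl
        (by omega)) h0
    | succ k ih =>
      intro j hj
      have hkm : k ≤ lo m := by omega
      have hle : (t.2 m).2 (indW (t.2 m) t.1 k, indC (t.2 m) (V t m) c j) ≤
          indC (t.2 m) (V t m) c (j + 1) :=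
        le_sup_of_le_right ((t.2 m).2.mono ⟨indW_le_indW le_rfl le_rfl hkm, le_rfl⟩)
      have := hS k m hm hkm (indW (t.2 m) t.1 k)
        (indW_le_indW (t.2.mono hm) le_rfl (hkm.trans hN))
        (indC (t.2 m) (V t m) c j)
        (indC_le_indC (t.2.mono hm) (V_le le_rfl hm) le_rfl (by change _ ≤ lo N; omega))
        (P.mono le_rfl hle (ih (j + 1) (by omega)))
      change P.R (s (Env.cons (σ := .nat) (k : ℕ) γ)) _ _ at this
      rw [hs] at this
      exact P.mono le_sup_right le_rfl this
  exact P.mono (indW_le_indW le_rfl le_rfl hn) le_rfl (key n 0 rfl)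

/-- The witness of the premise already maps majorants of `x` monotonically to bounds for `y`; its
first component becomes the choice functional, which returns a bound and not `y` itself. -/
theorem monotone_choice (P : Pred (Env (τ :: σ :: Γ)))
    {g : Env (τ :: σ :: .arr σ τ :: Γ) → Env (τ :: σ :: Γ)}
    (hg : ∀ y x f γ, g (Env.cons y (Env.cons x (Env.cons f γ))) = Env.cons y (Env.cons x γ)) :
    P.exMon.allMon ≤ (((P.pullback g).exMaj fun γ : Env (σ :: .arr σ τ :: Γ) =>
      (γ _ (.there .here) : El σ → El τ) (γ _ .here)).allMon).exMon := by
  refine le_of_R (P := P.exMon.allMon) (Q := (((P.pullback g).exMaj _).allMon).exMon)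
    (fun F : Bd σ →o Bd τ × P.W =>
      (Bd.up (El.ofHom (OrderHom.fst.comp F)) (El.maj_ofHom le_rfl), OrderHom.snd.comp F))
    (fun p => p.2)
    (fun _ _ h => ⟨Bd.up_le_up.2 (El.maj_ofHom fun m => (h m).1), fun m => (h m).2⟩)
    (fun _ _ h => h.2) fun γ F c h => ?_
  change Bd σ →o Bd τ × P.W at F
  refine ⟨El.ofHom (OrderHom.fst.comp F), Bd.maj_lo_up (El.maj_ofHom le_rfl) (El.maj_ofHom le_rfl),
    El.maj_ofHom le_rfl, fun x hx hm => ?_⟩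
  obtain ⟨y, hy, -, hP⟩ := h x hx hm
  refine ⟨y, ?_, ?_⟩
  · change Maj τ y ((El.ofHom (OrderHom.fst.comp F) : El σ → El τ) x)
    rw [El.ofHom_apply _ hx]
    exact hy
  · change P.R (g _) _ _
    rw [hg]
    exact hP

/-- Since `all` is uniform, one bound serves every `x`; its representative is the required `z`. -/
theorem realization (P : Pred (Env (τ :: σ :: Γ)))
    {g : Env (τ :: σ :: τ :: Γ) → Env (τ :: σ :: Γ)}
    (hg : ∀ y x z γ, g (Env.cons y (Env.cons x (Env.cons z γ))) = Env.cons y (Env.cons x γ)) :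
    P.exSt.all Env.cons ≤ (((P.pullback g).exMaj fun γ : Env (σ :: τ :: Γ) =>
      γ _ (.there .here)).all Env.cons).exMon := by
  refine le_of_R (P := P.exSt.all Env.cons)
    (Q := (((P.pullback g).exMaj _).all Env.cons).exMon) (fun w => w) (fun p => p.2)
    (fun _ _ h => h) (fun _ _ h => h.2) fun γ w c h => ?_
  refine ⟨_, w.1.lo_mono, w.1.lo_mono, fun x => ?_⟩
  obtain ⟨y, hy, hP⟩ := h x
  refine ⟨y, hy, ?_⟩
  change P.R (g _) _ _
  rw [hg]
  exact hP

/-- The challenge to the conclusion is a single bound on `y`. The premise at that bound supplies an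
`x`, which may vary with the challenge because `ex` does not record it. -/
theorem idealization {p : Env (τ :: σ :: Γ) → Prop} :
    (allMonProp fun γ : Env (τ :: Γ) =>
      ∃ x : El σ, ∀ y, Maj τ y (γ _ .here) → p (Env.cons y (Env.cons x γ.tail))) ≤
      ((ofProp p).allSt).ex Env.cons := by
  refine le_of_R (P := allMonProp _) (Q := ((ofProp p).allSt).ex Env.cons) (fun _ => ⊥)
    (fun q => q.2.1) (fun _ _ _ => le_rfl) (fun _ _ h => h.2.1) fun γ w c h => ?_
  obtain ⟨x, hx⟩ := h _ (Bd.lo_mono _) (Bd.lo_mono _)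
  exact ⟨x, fun y m hm hy => hx y (Bd.maj_of_le hy hm)⟩

theorem independence_of_premise {p : Env (σ :: Γ) → Prop} {q : Env (σ :: τ :: Γ) → Prop}
    (hq : ∀ x z γ, q (Env.cons x (Env.cons z γ)) ↔ p (Env.cons x γ)) (P : Pred (Env (τ :: Γ)))
    {g : Env (τ :: τ :: Γ) → Env (τ :: Γ)}
    (hg : ∀ y z γ, g (Env.cons y (Env.cons z γ)) = Env.cons y γ) :
    (allMonProp p).imp P.exMon ≤ ((allMonProp q).imp
      (((ofProp fun γ : Env (τ :: τ :: Γ) => Maj τ (γ _ .here) (γ _ .here)).and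
        (P.pullback g)).exMaj fun γ => γ _ .here)).exMon := by
  refine le_of_R (P := (allMonProp p).imp P.exMon)
    (Q := ((allMonProp q).imp (((ofProp _).and (P.pullback g)).exMaj _)).exMon)
    -- The premise has only the trivial witness, so the bound on `y` is the constant `(w.1 ()).1`,
    -- available before the premise is assumed.
    (fun w : (Unit →o Bd τ × P.W) × (Unit × P.C →o Bd σ) =>
      ((w.1 ()).1, (⟨fun _ => ((), (w.1 ()).2), fun _ _ _ => le_rfl⟩,
        ⟨fun r => w.2 ((), r.2.2), fun _ _ h => w.2.mono ⟨le_rfl, h.2.2⟩⟩)))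
    (fun r => ((), r.2.2.2))
    (fun _ _ h => ⟨(h.1 _).1, fun _ => ⟨le_rfl, (h.1 _).2⟩, fun _ => h.2 _⟩)
    (fun _ _ h => ⟨le_rfl, h.2.2.2⟩) fun γ w c h => ?_
  change (Unit →o Bd τ × P.W) × (Unit × P.C →o Bd σ) at w
  refine ⟨_, (w.1 ()).1.lo_mono, (w.1 ()).1.lo_mono, fun b _ e he hp => ?_⟩
  obtain ⟨y, hy, hyy, hP⟩ := h () le_rfl e.2 he.2 fun _ hx hm => (hq _ _ _).1 (hp _ hx hm)
  refine ⟨y, hy, hyy, ?_⟩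
  change P.R (g _) _ _
  rw [hg]
  exact hP

/-- The challenge component of an implication tells how much of the premise is used; here that is a
majorant, and it is the desired bound. -/
theorem markov {p : Env (σ :: Γ) → Prop} {q : Env Γ → Prop} :
    (allMonProp p).imp (ofProp q) ≤ (ofProp fun γ : Env (σ :: Γ) =>
      (∀ x, Maj σ x (γ _ .here) → p (Env.cons x γ.tail)) → q γ.tail).exMon := by
  refine le_of_R (P := (allMonProp p).imp (ofProp q)) (Q := (ofProp _).exMon)
    (fun w : (Unit →o Unit) × (Unit × Unit →o Bd σ) => (w.2 ((), ()), ())) (fun _ => ((), ()))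
    (fun _ _ h => ⟨h.2 _, le_rfl⟩) (fun _ _ _ => le_rfl) fun γ w c h => ?_
  exact ⟨_, Bd.lo_mono _, Bd.lo_mono _, fun hp => h () le_rfl () le_rfl fun x _ hm => hp x hm⟩

theorem majorizability {p : Env (σ :: σ :: Γ) → Prop}
    (h : ∀ x y γ, p (Env.cons y (Env.cons x γ)) ↔ Maj σ x y) :
    (top : Pred (Env Γ)) ≤ ((ofProp p).exSt).allSt :=
  le_of_R (Q := ((ofProp p).exSt).allSt)
    (fun _ => ⟨fun m => (m, ()), fun _ _ h => ⟨h, le_rfl⟩⟩) (fun _ => ()) (fun _ _ _ => le_rfl)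
    (fun _ _ _ => le_rfl) fun _ _ _ _ _ m _ hx => ⟨m.lo, m.lo_mono, (h _ _ _).2 hx⟩

/-- Content-free properties that hold for every `y` cost nothing, so only a majorant of `a` has to
be supplied. -/
theorem top_le_exSt_allSt {p : Env (τ :: σ :: Γ) → Prop} {a b : El σ} (hab : Maj σ a b)
    (h : ∀ y γ, p (Env.cons y (Env.cons a γ))) :
    (top : Pred (Env Γ)) ≤ ((ofProp p).allSt).exSt :=
  le_of_R (Q := ((ofProp p).allSt).exSt) (fun _ => (Bd.up b hab.right, ⊥)) (fun _ => ())
    (fun _ _ _ => le_rfl) (fun _ _ _ => le_rfl)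
    fun _ _ _ _ => ⟨a, Bd.maj_lo_up hab hab.right, fun y _ _ _ => h y _⟩

end Pred

theorem DGAxiom.valid {Γ : Ctx} {A : Fml .external Γ} (h : DGAxiom Γ A) :
    Pred.top ≤ A.interp := by
  cases h with
  | eha h => exact h.valid
  | st_eq σ s t =>
    exact Fml.valid_imp_imp (Pred.st_and_le (Fml.isProp_eqAt s t) fun γ h m hm => h ▸ hm)
  | st_maj σ s t =>
    exact Fml.valid_imp_imp (Pred.and_st_le (Fml.isProp_maj s t) fun γ h m hm => h.trans hm)
  | st_closed σ t =>
    obtain ⟨y, hy⟩ := t.eval_closed_majorizable (fun _ x => nomatch x)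
    refine Pred.le_of_R (Q := Pred.st _) (fun _ => Bd.up y hy.right) (fun _ => ())
      (fun _ _ _ => le_rfl) (fun _ _ _ => le_rfl) fun γ _ _ _ => Bd.maj_lo_up ?_ hy.right
    change Maj σ (t.ofClosed.eval γ) y
    rw [Tm.ofClosed, Tm.eval_subst]
    convert hy using 2
    funext _ x
    exact nomatch x
  | st_app σ τ s t => exact Fml.valid_imp_imp (Pred.st_app _ _)
  | ind_st Φ =>
    refine Pred.top_le_imp ?_
    refine le_trans (Pred.and_mono le_rfl (Fml.allSt_le le_rfl))
      (le_trans ?_ (Fml.le_allSt le_rfl))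
    rw [Fml.interp_inst, Fml.interp, Fml.atSucc, Fml.interp_subst]
    exact Pred.external_induction _ (fun _ => rfl) fun _ _ => Sub.eval_cons _ _ _
  | mAC σ τ Φ =>
    refine Pred.top_le_imp ((Fml.allMonSt_le (Fml.exMonSt_le le_rfl)).trans (le_trans ?_
      (Fml.le_exMonSt (Fml.le_allMonSt (Fml.le_exMaj le_rfl)))))
    rw [Fml.wk2, Fml.interp_subst]
    exact Pred.monotone_choice _ fun _ _ _ _ => by
      rw [Sub.eval_lift, Sub.eval_lift, Sub.eval_shift]
  | real σ τ Φ =>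
    refine Pred.top_le_imp ((Pred.all_mono _ (Fml.exSt_le le_rfl)).trans (le_trans ?_
      (Fml.le_exMonSt (Pred.all_mono _ (Fml.le_exMaj le_rfl)))))
    rw [Fml.wk2, Fml.interp_subst]
    exact Pred.realization _ fun _ _ _ _ => by
      rw [Sub.eval_lift, Sub.eval_lift, Sub.eval_shift]
  | ideal σ τ φ =>
    obtain ⟨p, hp⟩ := Fml.exists_isProp_emb (ℓ := .external) φ
    have hp' := hp.pullback (((Sub.shift τ).lift σ).lift τ).eval
    rw [← Fml.interp_subst, ← Fml.emb_subst] at hp'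
    have hp'' := ((Fml.isProp_allMaj (t := .v1) hp').ex Env.cons).congr
      (q := fun γ : Env (τ :: Γ) =>
        ∃ x : El σ, ∀ y, Maj τ y (γ _ .here) → p (Env.cons y (Env.cons x γ.tail))) fun γ => by
        simp only [Sub.eval_lift]
        exact Iff.rfl
    exact Pred.top_le_imp ((Fml.allMonSt_le_allMonProp
      (A := .ex σ (.allMaj τ .v1 (φ.wk2 τ).emb)) hp'').trans (Pred.idealization.trans
      (Pred.ex_mono _ (Fml.le_allSt hp.2))))
  | indepPrem σ τ φ Ψ =>
    obtain ⟨p, hp⟩ := Fml.exists_isProp_emb (ℓ := .external) φ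
    have hp' := hp.pullback ((Sub.shift τ).lift σ).eval
    rw [← Fml.interp_subst, ← Fml.emb_subst] at hp'
    refine Pred.top_le_imp ((Pred.imp_mono (Fml.allMonProp_le_allMonSt hp)
      (Fml.exMonSt_le le_rfl)).trans (le_trans ?_ (Fml.le_exMonSt (Pred.imp_mono
      (Fml.allMonSt_le_allMonProp hp') (Fml.le_exMaj (Pred.and_mono Fml.isProp_mono.2 le_rfl))))))
    rw [Fml.wk1, Fml.interp_subst]
    exact Pred.independence_of_premise (fun _ _ _ => by rw [Sub.eval_lift, Sub.eval_shift]) _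
      fun _ _ _ => by rw [Sub.eval_lift, Sub.eval_shift]
  | markov σ φ ψ =>
    obtain ⟨p, hp⟩ := Fml.exists_isProp_emb (ℓ := .external) φ
    obtain ⟨q, hq⟩ := Fml.exists_isProp_emb (ℓ := .external) ψ
    have hp' := hp.pullback ((Sub.shift σ).lift σ).eval
    rw [← Fml.interp_subst, ← Fml.emb_subst] at hp'
    have hq' := hq.pullback (Sub.shift σ).eval
    rw [← Fml.interp_subst, ← Fml.emb_subst] at hq'
    have h := ((Fml.isProp_allMaj (t := .v0) hp').imp hq').congr
      (q := fun γ : Env (σ :: Γ) =>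
        (∀ x, Maj σ x (γ _ .here) → p (Env.cons x γ.tail)) → q γ.tail) fun γ => by
        simp only [Sub.eval_lift]
        exact Iff.rfl
    exact Pred.top_le_imp ((Pred.imp_mono (Fml.allMonProp_le_allMonSt hp) hq.1).trans
      (Pred.markov.trans (Fml.le_exMonSt h.2)))
  | majAx σ =>
    exact (Pred.majorizability fun _ _ _ => Iff.rfl).trans
      (Fml.le_allSt (Fml.le_exSt (Fml.isProp_maj _ _).2))

/-! ### The Turing jump. -/

theorem isProp_TJ {ℓ : Lang} {Γ : Ctx} (f : Tm Γ .one) (φ : Tm Γ .two) :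
    (TJ (ℓ := ℓ) f φ).interp.IsProp fun γ =>
      (∃ n : ℕ, Eq (α := ℕ) ((f.eval γ : ℕ → El .nat) n) 0) ↔
        Eq (α := ℕ) ((φ.eval γ : El .one → El .nat) (f.eval γ)) 0 := by
  have h := (Pred.IsProp.ofProp fun γ : Env (.nat :: Γ) =>
    (Tm.app (f.wk .nat) .v0).eval γ = Tm.zero.eval γ).ex (A := El .nat) Env.cons
  have k := Pred.IsProp.ofProp fun γ : Env Γ => (Tm.app φ f).eval γ = Tm.zero.eval γ
  refine ((h.imp k).and (k.imp h)).congr fun γ => ?_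
  simp only [Tm.eval, Tm.eval_wk]
  exact iff_def.symm

open Classical in
/-- The Turing jump functional is majorized by a constant functional. -/
theorem existsTwoStd_valid (Γ : Ctx) : Pred.top ≤ (existsTwoStd Γ).interp := by
  refine le_trans ?_ (Fml.le_exSt (Fml.le_allSt (isProp_TJ _ _).2))
  refine Pred.top_le_exSt_allSt (σ := .two)
    (a := fun f : ℕ → ℕ => if ∃ n, f n = 0 then (0 : ℕ) else (1 : ℕ))
    (b := fun _ => (1 : ℕ)) (fun v u _ => ⟨?_, Nat.le_refl 1⟩) fun f γ => ?_
  -- The bound is independent of the argument, so no continuity of the functional is needed.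
  · change (if _ then (0 : ℕ) else 1) ≤ 1
    split <;> omega
  · change ℕ → ℕ at f
    change (∃ n : ℕ, f n = 0) ↔ (if ∃ n : ℕ, f n = 0 then 0 else 1) = 0
    split <;> simp_all

/-- The interpretation over the full type structure validates every axiom of the nonstandard
system with the Turing jump functional. -/
theorem consistent_DG_existsTwoStd : Consistent (DG.plus existsTwoStd) :=
  consistent_of_valid fun {Γ _} h => by
    rcases h with h | rfl
    · exact DGAxiom.valid h
    · exact existsTwoStd_valid Γ

end FiniteType

theorem mainTheorem4 :
    FiniteType.Consistent (FiniteType.EHAω.plus FiniteType.existsTwo) →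
      FiniteType.Consistent (FiniteType.DG.plus FiniteType.existsTwoStd) :=
  fun _ => FiniteType.consistent_DG_existsTwoStd
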